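/- For a prime $q$ write $\mathbf{e}_q(z)=\exp(2\pi i z/q)$, and for a positive integer $A$ let $m\sim A$ mean that $m$ is an integer with $A/2\le m<A$. For $a,h\in\mathbb{F}_q$, positive integers $M,N$ and complex weights $\boldsymbol\alpha=(\alpha_m)_{m\sim M}$, $\boldsymbol\beta=(\beta_n)_{n\sim N}$, put $$ W_{a,q}(\boldsymbol\alpha,\boldsymbol\beta;h,M,N)=\sum_{m\sim M}\sum_{n\sim N}\alpha_m\beta_n\sum_{\substack{x\in\mathbb{F}_q\\ x^2=amn}}\mathbf{e}_q(hx). $$ Then for every $\varepsilon>0$ there is a $q_0=q_0(\varepsilon)$ such that for every prime $q\ge q_0$, all $a,h\in\mathbb{F}_q^*$, all positive integers $M,N\le q/2$, and all weights with $|\alpha_m|\le 1$ for $m\sim M$ and $|\beta_n|\le 1$ for $n\sim N$, $$ |W_{a,q}(\boldsymbol\alpha,\boldsymbol\beta;h,M,N)|\le q^{1/8+\varepsilon}(NM)^{3/4}\left(\frac{N^{3/16}}{q^{1/16}}+1\right)\left(\frac{M^{3/16}}{q^{1/16}}+1\right). $$ -/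

import Mathlib

/-- The positive integers `m` with `m ∼ M`, that is, in the dyadic interval `M / 2 ≤ m < M`
(for `M ≥ 1` such an `m` is automatically positive). -/
def dyadicInterval (M : ℕ) : Finset ℕ :=
  (Finset.range M).filter (fun m => M ≤ 2 * m)

/-- The bilinear form over modular square roots
`W_{a,q}(α, β; h, M, N) = ∑_{m ∼ M} ∑_{n ∼ N} α_m β_n ∑_{x ∈ 𝔽_q, x ^ 2 = a m n} e_q(h x)`.
Here `ZMod.stdAddChar` is the additive character `e_q(j) = exp(2 π i j / q)` of `ZMod q`. -/
noncomputable def bilinearRootSum (q : ℕ) [NeZero q] (a h : ZMod q) (α β : ℕ → ℂ) (M N : ℕ) : ℂ :=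
  ∑ m ∈ dyadicInterval M, ∑ n ∈ dyadicInterval N,
    α m * β n *
      ∑ x ∈ (Finset.univ : Finset (ZMod q)).filter
          (fun x => x ^ 2 = a * (m : ZMod q) * (n : ZMod q)),
        ZMod.stdAddChar (h * x)

open Finset

/-! For each nonzero `c`, a root `x` of `a m n` can be split as `x = u v` with `u ^ 2 = c m` and `v
^ 2 = (a / c) n`. Averaged over `c`, this writes the sum as a mean of genuinely bilinear forms in
`e_q(h u v)` over two root sets (`nsmul_bilinearRootSum`). The Cauchy–Schwarz inequality, used three
times, bounds the eighth power of such a form by `(#A #B) ^ 4 q E(A) E(B)`, with `E` the additive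
energy (`norm_bilinear_pow_eight_le`).

It remains to show `E ≤ N ^ 2 (1 + √(N ^ 3 / q)) q ^ o(1)` for a root set (`sum_diffCount_sq_le`).
If `u - v = l`, then `|m - n|` and `m + n` are the coordinates of a point on a parabola modulo `q`
depending on `l`. Differences of such points lie in the lattice `x ≡ κ y (mod q)`, in an `N ^ 2 × N`
box. If the lattice points of the box are not collinear, they number `O(N ^ 3 / q)` and the divisor
bound finishes. If they are collinear, their direction `(± s, t)` imposes congruences modulo the
factors of `s`. The resulting bound can be large for a single `l`, but each `(s, t)` serves at most
four `l`, and the sum over all `(s, t)` of its square is `N ^ 2 q ^ o(1)`. -/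

/-! ### Divisor bound and harmonic sums -/

/-- Both sides are products over primes. A prime with `p ^ δ ≥ 2` satisfies `v + 1 ≤ p ^ (v δ)` at
no cost; each of the at most `Q` smaller ones costs a factor `c`. -/
theorem exists_card_divisors_le (δ : ℝ) (hδ : 0 < δ) :
    ∃ C : ℝ, 1 ≤ C ∧ ∀ n : ℕ, n ≠ 0 → (#n.divisors : ℝ) ≤ C * (n : ℝ) ^ δ := by
  obtain ⟨Q, hQ⟩ := exists_nat_ge ((2 : ℝ) ^ (1 / δ))
  set b : ℝ := δ * Real.log 2 with hb
  have hb0 : 0 < b := mul_pos hδ (Real.log_pos (by norm_num))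
  -- Chosen so that `v + 1 ≤ c (1 + v b)`, while `1 + v b ≤ exp (v b) = 2 ^ (v δ)`.
  set c : ℝ := 1 + 1 / b with hc
  have hc1 : 1 ≤ c := by rw [hc]; have := one_div_pos.2 hb0; linarith
  have hlocal : ∀ p v : ℕ, 2 ≤ p →
      ((v : ℝ) + 1) ≤ (if p < Q then c else 1) * ((p : ℝ) ^ v) ^ δ := by
    intro p v hp
    have hp0 : (0 : ℝ) ≤ p := Nat.cast_nonneg p
    have hswap : ((p : ℝ) ^ v) ^ δ = ((p : ℝ) ^ δ) ^ v := by
      rw [← Real.rpow_natCast, ← Real.rpow_natCast, ← Real.rpow_mul hp0, ← Real.rpow_mul hp0,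
        mul_comm]
    rw [hswap]
    split_ifs with hpQ
    · have h2 : Real.exp b ≤ (p : ℝ) ^ δ := by
        have : Real.exp b = (2 : ℝ) ^ δ := by
          rw [Real.rpow_def_of_pos (by norm_num), hb, mul_comm]
        rw [this]
        exact Real.rpow_le_rpow (by norm_num) (by exact_mod_cast hp) hδ.le
      have h3 : 1 + v * b ≤ ((p : ℝ) ^ δ) ^ v := by
        calc 1 + v * b ≤ Real.exp (v * b) := by linarith [Real.add_one_le_exp ((v : ℝ) * b)]
          _ = Real.exp b ^ v := Real.exp_nat_mul b v
          _ ≤ _ := pow_le_pow_left₀ (Real.exp_pos b).le h2 v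
      calc (v : ℝ) + 1 ≤ c * (1 + v * b) := by
            rw [hc]
            have : (1 + 1 / b) * (1 + v * b) = v + 1 + (1 / b + v * b) := by
              field_simp; ring
            rw [this]
            have : 0 ≤ 1 / b + v * b := by positivity
            linarith
        _ ≤ _ := mul_le_mul_of_nonneg_left h3 (by linarith)
    · have h2 : (2 : ℝ) ≤ (p : ℝ) ^ δ := by
        have h4 : (2 : ℝ) ^ (1 / δ) ≤ p := hQ.trans (by exact_mod_cast not_lt.1 hpQ)
        calc (2 : ℝ) = ((2 : ℝ) ^ (1 / δ)) ^ δ := by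
              rw [← Real.rpow_mul (by norm_num), one_div_mul_cancel hδ.ne', Real.rpow_one]
          _ ≤ _ := Real.rpow_le_rpow (by positivity) h4 hδ.le
      rw [one_mul]
      calc (v : ℝ) + 1 ≤ 2 ^ v := by exact_mod_cast Nat.lt_two_pow_self
        _ ≤ _ := pow_le_pow_left₀ (by norm_num) h2 v
  refine ⟨c ^ Q, one_le_pow₀ hc1, fun n hn => ?_⟩
  have hprod : ∏ p ∈ n.primeFactors, (if p < Q then c else 1) ≤ c ^ Q := by
    rw [← prod_filter, prod_const]
    refine pow_le_pow_right₀ hc1 ?_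
    calc #(n.primeFactors.filter (· < Q)) ≤ #(range Q) :=
          card_le_card fun p hp => mem_range.2 (mem_filter.1 hp).2
      _ = Q := card_range Q
  have hn' : (n : ℝ) ^ δ = ∏ p ∈ n.primeFactors, ((p : ℝ) ^ n.factorization p) ^ δ := by
    rw [Real.finsetProd_rpow _ _ (fun p _ => by positivity)]
    congr 1
    exact_mod_cast (Nat.prod_factorization_pow_eq_self hn).symm
  rw [Nat.card_divisors hn, hn']
  push_cast
  calc ∏ p ∈ n.primeFactors, ((n.factorization p : ℝ) + 1)
      ≤ ∏ p ∈ n.primeFactors,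
          ((if p < Q then c else 1) * ((p : ℝ) ^ n.factorization p) ^ δ) :=
        prod_le_prod (fun p _ => by positivity)
          fun p hp => hlocal p _ (Nat.prime_of_mem_primeFactors hp).two_le
    _ = _ := prod_mul_distrib
    _ ≤ _ := mul_le_mul_of_nonneg_right hprod (prod_nonneg fun p _ => by positivity)

theorem exists_sum_inv_le (δ : ℝ) (hδ : 0 < δ) :
    ∃ C : ℝ, 1 ≤ C ∧ ∀ n : ℕ, n ≠ 0 → ∑ k ∈ Icc 1 n, (1 : ℝ) / k ≤ C * (n : ℝ) ^ δ := by
  refine ⟨1 + 1 / δ, by have := one_div_pos.2 hδ; linarith, fun n hn => ?_⟩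
  have h1 : (1 : ℝ) ≤ n := by exact_mod_cast Nat.one_le_iff_ne_zero.2 hn
  have h : ∑ k ∈ Icc 1 n, (1 : ℝ) / k = ((harmonic n : ℚ) : ℝ) := by
    rw [harmonic_eq_sum_Icc]; push_cast; simp
  rw [h]
  have h2 := harmonic_le_one_add_log n
  have h3 := Real.log_le_rpow_div (x := n) (by linarith) hδ
  have h4 : (1 : ℝ) ≤ (n : ℝ) ^ δ := Real.one_le_rpow h1 hδ.le
  calc _ ≤ _ := h2
    _ ≤ (n : ℝ) ^ δ + (n : ℝ) ^ δ / δ := add_le_add h4 h3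
    _ = _ := by ring

/-! ### Lattice points in a box -/

/-- The points of the lattice `x ≡ κ y (mod q)` in the box `|x| ≤ N ^ 2`, `|y| ≤ N`. -/
noncomputable def latticeBox (q : ℕ) (κ : ZMod q) (N : ℕ) : Finset (ℤ × ℤ) :=
  (Icc (-((N : ℤ) ^ 2)) ((N : ℤ) ^ 2) ×ˢ Icc (-(N : ℤ)) N).filter
    (fun w => ((w.1 : ℤ) : ZMod q) = κ * ((w.2 : ℤ) : ZMod q))

theorem mem_latticeBox {q : ℕ} {κ : ZMod q} {N : ℕ} {w : ℤ × ℤ} :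
    w ∈ latticeBox q κ N ↔ |w.1| ≤ (N : ℤ) ^ 2 ∧ |w.2| ≤ N ∧
      ((w.1 : ℤ) : ZMod q) = κ * ((w.2 : ℤ) : ZMod q) := by
  simp [latticeBox, abs_le, and_assoc]

theorem dvd_cross_of_mem_latticeBox {q : ℕ} {κ : ZMod q} {N : ℕ} {v w : ℤ × ℤ}
    (hv : v ∈ latticeBox q κ N) (hw : w ∈ latticeBox q κ N) :
    (q : ℤ) ∣ v.1 * w.2 - v.2 * w.1 := by
  rw [← ZMod.intCast_zmod_eq_zero_iff_dvd]
  push_cast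
  rw [(mem_latticeBox.1 hv).2.2, (mem_latticeBox.1 hw).2.2]
  ring

/-- Either the lattice points in the box are collinear with the origin, or there are at most as
many as the volume of the box suggests. -/
theorem latticeBox_collinear_or_card_le (q : ℕ) (hq : 0 < q) (κ : ZMod q) (N : ℕ) (hN : 0 < N) :
    (∃ v ∈ latticeBox q κ N, v ≠ 0 ∧ ∀ w ∈ latticeBox q κ N, v.1 * w.2 = v.2 * w.1) ∨
      (∀ w ∈ latticeBox q κ N, w = 0) ∨ #(latticeBox q κ N) * q ≤ 24 * N ^ 3 := by
  by_cases hne : ∀ w ∈ latticeBox q κ N, w = 0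
  · exact Or.inr (Or.inl hne)
  push Not at hne
  set P := latticeBox q κ N with hP
  have hN' : (0 : ℤ) < N := by exact_mod_cast hN
  have hq' : (0 : ℤ) < q := by exact_mod_cast hq
  obtain ⟨w₀, hw₀, hw₀0⟩ := hne
  -- A shortest nonzero vector for the norm `max |x| (N |y|)`, whose ball of radius `N ^ 2` is the
  -- box.
  obtain ⟨v, hv, hmin⟩ := exists_min_image (P.filter (· ≠ 0))
    (fun w => max |w.1| (N * |w.2|)) ⟨w₀, by simp [hw₀, hw₀0]⟩
  rw [mem_filter] at hv
  obtain ⟨hvP, hv0⟩ := hv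
  obtain ⟨hv1, hv2, hvκ⟩ := mem_latticeBox.1 hvP
  obtain ⟨l, hl⟩ : ∃ l : ℤ, l = max |v.1| (N * |v.2|) := ⟨_, rfl⟩
  have hl1 : |v.1| ≤ l := hl ▸ le_max_left _ _
  have hl2 : N * |v.2| ≤ l := hl ▸ le_max_right _ _
  have hl0 : 0 < l := by
    rcases (abs_nonneg v.1).lt_or_eq with h | h
    · exact h.trans_le hl1
    · have : v.2 ≠ 0 := fun h2 => hv0 (Prod.ext (abs_eq_zero.1 h.symm) h2)
      exact (mul_pos hN' (abs_pos.2 this)).trans_le hl2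
  have hlN : l ≤ (N : ℤ) ^ 2 := by
    rw [hl, max_le_iff]
    exact ⟨hv1, by nlinarith⟩
  by_cases hcol : ∀ w ∈ P, v.1 * w.2 = v.2 * w.1
  · exact Or.inl ⟨v, hvP, hv0, hcol⟩
  refine Or.inr (Or.inr ?_)
  have hcross : ∀ w ∈ P, |v.1 * w.2 - v.2 * w.1| ≤ 2 * l * N := by
    intro w hw
    obtain ⟨h1, h2, -⟩ := mem_latticeBox.1 hw
    have ha : |v.1 * w.2| ≤ l * N := by
      rw [abs_mul]; exact mul_le_mul hl1 h2 (abs_nonneg _) hl0.le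
    have hb : |v.2 * w.1| ≤ l * N := by
      rw [abs_mul]
      calc |v.2| * |w.1| ≤ |v.2| * (N : ℤ) ^ 2 := mul_le_mul_of_nonneg_left h1 (abs_nonneg _)
        _ = N * |v.2| * N := by ring
        _ ≤ l * N := mul_le_mul_of_nonneg_right hl2 hN'.le
    have := abs_sub (v.1 * w.2) (v.2 * w.1)
    linarith
  -- The cross product with `v` is a multiple of `q` of size at most `2 l N`, so about `2 K + 1`
  -- lines parallel to `v` occur, each holding about `N ^ 2 / l` points. The length `l` cancels in
  -- the product. A non-collinear point forces `K ≥ 1`, which absorbs the rounding.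
  obtain ⟨K, hK⟩ : ∃ K : ℤ, K = 2 * l * N / q := ⟨_, rfl⟩
  obtain ⟨k, hk⟩ : ∃ k : ℤ, k = (N : ℤ) ^ 2 / l := ⟨_, rfl⟩
  have hKq : K * q ≤ 2 * l * N := hK ▸ Int.ediv_mul_le _ hq'.ne'
  have hkl : k * l ≤ (N : ℤ) ^ 2 := hk ▸ Int.ediv_mul_le _ hl0.ne'
  have hK1 : 1 ≤ K := by
    push Not at hcol
    obtain ⟨w, hw, hne⟩ := hcol
    have h1 := Int.le_of_dvd (abs_pos.2 (sub_ne_zero.2 hne))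
      ((dvd_abs _ _).2 (dvd_cross_of_mem_latticeBox hvP hw))
    rw [hK, Int.le_ediv_iff_mul_le hq', one_mul]
    exact h1.trans (hcross w hw)
  have hk1 : 1 ≤ k := by rw [hk, Int.le_ediv_iff_mul_le hl0, one_mul]; exact hlN
  -- `z` is the coordinate attaining the norm of `v`; on multiples of `v` it controls the whole
  -- norm.
  obtain ⟨z, hzbd, hzadd, hzmin⟩ : ∃ z : ℤ × ℤ → ℤ, (∀ w ∈ P, |z w| ≤ (N : ℤ) ^ 2) ∧
      (∀ w w', z (w - w') = z w - z w') ∧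
      (∀ d : ℤ × ℤ, v.1 * d.2 = v.2 * d.1 → |z d| < l → |d.1| < l ∧ N * |d.2| < l) := by
    rcases max_choice |v.1| (N * |v.2|) with h | h
    · rw [← hl] at h
      refine ⟨fun w => w.1, fun w hw => (mem_latticeBox.1 hw).1, fun _ _ => rfl,
        fun d hd hdl => ⟨hdl, lt_of_le_of_lt ?_ hdl⟩⟩
      have h3 : |v.1| * |d.2| = |v.2| * |d.1| := by rw [← abs_mul, ← abs_mul, hd]
      rw [← h] at h3
      refine le_of_mul_le_mul_left ?_ hl0
      calc l * (N * |d.2|) = N * (l * |d.2|) := by ring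
        _ = N * |v.2| * |d.1| := by rw [h3]; ring
        _ ≤ _ := mul_le_mul_of_nonneg_right hl2 (abs_nonneg _)
    · rw [← hl] at h
      refine ⟨fun w => N * w.2, fun w hw => ?_, fun w w' => by simp [mul_sub],
        fun d hd hdl => ?_⟩
      · rw [abs_mul, Nat.abs_cast]
        nlinarith [(mem_latticeBox.1 hw).2.1]
      · rw [abs_mul, Nat.abs_cast] at hdl
        refine ⟨lt_of_le_of_lt ?_ hdl, hdl⟩
        have h3 : |v.1| * |d.2| = |v.2| * |d.1| := by rw [← abs_mul, ← abs_mul, hd]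
        refine le_of_mul_le_mul_left ?_ hl0
        calc l * |d.1| = N * (|v.2| * |d.1|) := by rw [h]; ring
          _ = N * |d.2| * |v.1| := by rw [← h3]; ring
          _ ≤ N * |d.2| * l := mul_le_mul_of_nonneg_left hl1 (by positivity)
          _ = _ := by ring
  -- Two points on one line and in one cell of length `l` would differ by a vector shorter than `v`.
  -- Floor division of negative values accounts for `-k - 1`.
  have hcard : #P ≤ #(Icc (-K) K ×ˢ Icc (-k - 1) k) := by
    refine card_le_card_of_injOn (fun w => ((v.1 * w.2 - v.2 * w.1) / q, z w / l)) ?_ ?_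
    · intro w hw
      have h1 := abs_le.1 (hcross w hw)
      have h2 := abs_le.1 (hzbd w hw)
      have hd := Int.ediv_mul_cancel (dvd_cross_of_mem_latticeBox hvP hw)
      simp only [coe_product, coe_Icc, Set.mem_prod, Set.mem_Icc]
      refine ⟨⟨?_, ?_⟩, ?_, ?_⟩
      · have : -((v.1 * w.2 - v.2 * w.1) / (q : ℤ)) ≤ K := by
          rw [hK, Int.le_ediv_iff_mul_le hq']; linarith
        linarith
      · rw [hK, Int.le_ediv_iff_mul_le hq']; linarith
      · rw [Int.le_ediv_iff_mul_le hl0]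
        have : (N : ℤ) ^ 2 < (k + 1) * l := by
          rw [hk]; exact Int.lt_ediv_add_one_mul_self _ hl0
        linarith
      · rw [hk]; exact Int.ediv_le_ediv hl0 h2.2
    · intro w hw w' hw' heq
      simp only [Prod.mk.injEq] at heq
      obtain ⟨h1, h2⟩ := heq
      have hc : v.1 * w.2 - v.2 * w.1 = v.1 * w'.2 - v.2 * w'.1 := by
        rw [← Int.ediv_mul_cancel (dvd_cross_of_mem_latticeBox hvP hw), h1,
          Int.ediv_mul_cancel (dvd_cross_of_mem_latticeBox hvP hw')]
      have hz : |z (w - w')| < l := by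
        rw [hzadd, abs_lt]
        have e1 := Int.mul_ediv_add_emod (z w) l
        have e2 := Int.mul_ediv_add_emod (z w') l
        have e3 := Int.emod_nonneg (z w) hl0.ne'
        have e4 := Int.emod_nonneg (z w') hl0.ne'
        have e5 := Int.emod_lt_of_pos (z w) hl0
        have e6 := Int.emod_lt_of_pos (z w') hl0
        rw [h2] at e1
        constructor <;> linarith
      obtain ⟨g1, g2⟩ := hzmin (w - w') (by simp only [Prod.fst_sub, Prod.snd_sub]; linarith) hz
      by_contra hne
      have hmem : w - w' ∈ P := by
        refine mem_latticeBox.2 ⟨g1.le.trans hlN, ?_, ?_⟩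
        · nlinarith
        · have e1 := (mem_latticeBox.1 hw).2.2
          have e2 := (mem_latticeBox.1 hw').2.2
          simp only [Prod.fst_sub, Prod.snd_sub, Int.cast_sub]
          rw [e1, e2]; ring
      have := hmin (w - w') (mem_filter.2 ⟨hmem, sub_ne_zero.2 hne⟩)
      rw [← hl] at this
      exact absurd this (not_le.2 (max_lt g1 g2))
  have hcard' : (#P : ℤ) ≤ (2 * K + 1) * (2 * k + 2) := by
    have h1 : ((#(Icc (-K) K ×ˢ Icc (-k - 1) k) : ℕ) : ℤ) = (2 * K + 1) * (2 * k + 2) := by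
      rw [card_product, Int.card_Icc, Int.card_Icc]
      push_cast
      rw [Int.toNat_of_nonneg (by linarith), Int.toNat_of_nonneg (by linarith)]
      ring
    rw [← h1]; exact_mod_cast hcard
  have hfin : (#P : ℤ) * q ≤ 24 * (N : ℤ) ^ 3 := by
    calc (#P : ℤ) * q ≤ (2 * K + 1) * (2 * k + 2) * q :=
          mul_le_mul_of_nonneg_right hcard' hq'.le
      _ ≤ (3 * K) * (4 * k) * q := by gcongr <;> linarith
      _ = 12 * k * (K * q) := by ring
      _ ≤ 12 * k * (2 * l * N) := by gcongr
      _ = 24 * N * (k * l) := by ring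
      _ ≤ 24 * N * (N : ℤ) ^ 2 := by gcongr
      _ = _ := by ring
  exact_mod_cast hfin

/-! ### Points on a parabola modulo `q` -/

theorem natCast_zmod_ne_zero {q n : ℕ} (h0 : 0 < n) (hn : n < q) : (n : ZMod q) ≠ 0 := by
  rw [Ne, ZMod.natCast_eq_zero_iff]
  exact fun h => absurd (Nat.le_of_dvd h0 h) (not_le.2 hn)

theorem sq_sub_sq_ne_zero {a b : ℕ} (h : a ≠ b) : (a : ℤ) ^ 2 - (b : ℤ) ^ 2 ≠ 0 := by
  intro h0
  have : (a : ℤ) ^ 2 = (b : ℤ) ^ 2 := by linarith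
  exact h (Nat.pow_left_injective (n := 2) (by norm_num) (by exact_mod_cast this))

/-- Abscissas of points on a parabola modulo `q`: either there are few of them, or the
differences of the points all lie on one line through the origin with small integer direction
`(± s, t)`. -/
theorem parabola_card_le_or_collinear {q : ℕ} [Fact q.Prime] {κ ν : ZMod q} {N T : ℕ}
    (hκ : κ ≠ 0) (hN : 0 < N) (hNq : 2 * N ≤ q) (D : Finset ℕ) (σ : ℕ → ℤ) (hD : ∀ d ∈ D, d < N)
    (hσ : ∀ d ∈ D, ∀ d' ∈ D, |σ d - σ d'| ≤ N)
    (hpar : ∀ d ∈ D, (d : ZMod q) ^ 2 = κ * (σ d : ZMod q) - ν)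
    (hT : ∀ n, n ≠ 0 → n ≤ N ^ 2 → #n.divisors ≤ T) :
    #D ≤ 1 ∨ (#D * #D - #D) * q ≤ 24 * T * N ^ 3 ∨
      ∃ s ∈ Icc 1 (N ^ 2), ∃ t ∈ Icc 1 N, (κ * (t : ZMod q) = s ∨ κ * (t : ZMod q) = -s) ∧
        ∀ d ∈ D, ∀ d' ∈ D, (s : ℤ) ∣ (d : ℤ) ^ 2 - (d' : ℤ) ^ 2 ∧
          (t : ℤ) * ((d : ℤ) ^ 2 - (d' : ℤ) ^ 2) ≤ s * N := by
  have hqp := (Fact.out : q.Prime)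
  have hbox : ∀ d ∈ D, ∀ d' ∈ D,
      ((d : ℤ) ^ 2 - (d' : ℤ) ^ 2, σ d - σ d') ∈ latticeBox q κ N := by
    intro d hd d' hd'
    refine mem_latticeBox.2 ⟨?_, hσ d hd d' hd', ?_⟩
    · have h1 : (d : ℤ) < N := by exact_mod_cast hD d hd
      have h2 : (d' : ℤ) < N := by exact_mod_cast hD d' hd'
      rw [abs_le]; constructor <;> nlinarith
    · push_cast
      rw [hpar d hd, hpar d' hd']; ring
  -- In a direction with `v.2 = 0` the ordinate `σ` is constant, hence so is `d ^ 2` modulo `q`; as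
  -- `d + d' < q`, this determines `d`.
  have hsub : ∀ v ∈ latticeBox q κ N, (∀ d ∈ D, ∀ d' ∈ D,
      v.1 * (σ d - σ d') = v.2 * ((d : ℤ) ^ 2 - (d' : ℤ) ^ 2)) → v ≠ 0 → v.2 = 0 →
      #D ≤ 1 := by
    intro v hv hcol hv0 hv2
    rw [card_le_one]
    intro d hd d' hd'
    have h1 : v.1 ≠ 0 := fun h => hv0 (Prod.ext h hv2)
    have h2 := hcol d hd d' hd'
    rw [hv2, zero_mul, mul_eq_zero, or_iff_right h1] at h2
    have h3 := (mem_latticeBox.1 (hbox d hd d' hd')).2.2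
    simp only [h2, Int.cast_zero, mul_zero] at h3
    push_cast at h3
    have h4 : ((d : ZMod q) - d') * ((d : ZMod q) + d') = 0 := by rw [← h3]; ring
    have hdN := hD d hd
    have hdN' := hD d' hd'
    rcases mul_eq_zero.1 h4 with h | h
    · have := (ZMod.natCast_eq_natCast_iff' _ _ _).1 (sub_eq_zero.1 h)
      rwa [Nat.mod_eq_of_lt (by omega), Nat.mod_eq_of_lt (by omega)] at this
    · by_contra hne
      exact natCast_zmod_ne_zero (q := q) (n := d + d') (by omega) (by omega) (by exact_mod_cast h)
  rcases latticeBox_collinear_or_card_le q hqp.pos κ N hN with ⟨v, hv, hv0, hcol⟩ | h0 | hcard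
  · by_cases hv2 : v.2 = 0
    · exact Or.inl (hsub v hv (fun d hd d' hd' => hcol _ (hbox d hd d' hd')) hv0 hv2)
    right; right
    obtain ⟨hb1, hb2, hbκ⟩ := mem_latticeBox.1 hv
    have hn2 : 0 < v.2.natAbs := Int.natAbs_pos.2 hv2
    have hn2N : v.2.natAbs ≤ N := by zify; exact hb2
    have hn1N : v.1.natAbs ≤ N ^ 2 := by zify; exact hb1
    have hv2q : ((v.2 : ℤ) : ZMod q) ≠ 0 := by
      rw [Ne, ZMod.intCast_zmod_eq_zero_iff_dvd, Int.natCast_dvd]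
      exact fun h => absurd (Nat.le_of_dvd hn2 h) (by omega)
    have hv1 : v.1 ≠ 0 := by
      intro h
      rw [h, Int.cast_zero] at hbκ
      exact (mul_ne_zero hκ hv2q) hbκ.symm
    -- Passing to a primitive direction: coprimality of `s` and `t` later gives `s ∣ d ^ 2 - d' ^
    -- 2`.
    obtain ⟨g, s, t, hg, hst, hs, ht⟩ :
        ∃ g s t : ℕ, 0 < g ∧ s.Coprime t ∧ v.1.natAbs = s * g ∧ v.2.natAbs = t * g := by
      obtain ⟨s, t, h⟩ := Nat.exists_coprime v.1.natAbs v.2.natAbs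
      exact ⟨_, s, t, Nat.gcd_pos_of_pos_right _ hn2, h⟩
    have hs0 : 0 < s := Nat.pos_of_ne_zero fun h => hv1 (by simpa [h] using hs)
    have ht0 : 0 < t := Nat.pos_of_ne_zero fun h => hv2 (by simpa [h] using ht)
    refine ⟨s, mem_Icc.2 ⟨hs0, ?_⟩, t, mem_Icc.2 ⟨ht0, ?_⟩, ?_, ?_⟩
    · exact (Nat.le_mul_of_pos_right s hg).trans (hs ▸ hn1N)
    · exact (Nat.le_mul_of_pos_right t hg).trans (ht ▸ hn2N)
    · have hgq : (g : ZMod q) ≠ 0 := by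
        refine natCast_zmod_ne_zero hg ?_
        have := Nat.le_mul_of_pos_left g ht0
        omega
      have e1 : ((v.1.natAbs : ℤ) : ZMod q) = s * g := by rw [hs]; push_cast; ring
      have e2 : ((v.2.natAbs : ℤ) : ZMod q) = t * g := by rw [ht]; push_cast; ring
      rcases Int.natAbs_eq v.1 with h1 | h1 <;> rcases Int.natAbs_eq v.2 with h2 | h2 <;>
        rw [h1, h2] at hbκ <;>
        simp only [Int.cast_neg, Int.cast_natCast] at hbκ e1 e2
      · exact Or.inl (mul_right_cancel₀ hgq (by linear_combination e1 - hbκ - κ * e2))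
      · exact Or.inr (mul_right_cancel₀ hgq (by linear_combination -e1 + hbκ - κ * e2))
      · exact Or.inr (mul_right_cancel₀ hgq (by linear_combination -e1 - hbκ - κ * e2))
      · exact Or.inl (mul_right_cancel₀ hgq (by linear_combination e1 + hbκ - κ * e2))
    · intro d hd d' hd'
      have h1 := congrArg Int.natAbs (hcol _ (hbox d hd d' hd'))
      simp only [Int.natAbs_mul] at h1
      rw [hs, ht] at h1
      have h2 : s * (σ d - σ d').natAbs = t * ((d : ℤ) ^ 2 - (d' : ℤ) ^ 2).natAbs := by
        refine Nat.eq_of_mul_eq_mul_right hg ?_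
        linarith
      refine ⟨?_, ?_⟩
      · rw [Int.natCast_dvd]
        exact hst.dvd_of_dvd_mul_left ⟨_, h2.symm⟩
      · have h3 : (s : ℤ) * |σ d - σ d'| = t * |(d : ℤ) ^ 2 - (d' : ℤ) ^ 2| := by
          rw [Int.abs_eq_natAbs, Int.abs_eq_natAbs]; exact_mod_cast h2
        calc (t : ℤ) * ((d : ℤ) ^ 2 - (d' : ℤ) ^ 2) ≤ t * |(d : ℤ) ^ 2 - (d' : ℤ) ^ 2| := by
              gcongr; exact le_abs_self _
          _ = s * |σ d - σ d'| := h3.symm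
          _ ≤ s * N := by gcongr; exact hσ d hd d' hd'
  · left
    rw [card_le_one]
    intro d hd d' hd'
    by_contra hne
    exact sq_sub_sq_ne_zero hne (congrArg Prod.fst (h0 _ (hbox d hd d' hd')))
  · right; left
    -- A pair `d ≠ d'` is recovered from `d ^ 2 - d' ^ 2` and its divisor `|d - d'|`, so each fibre
    -- has at most `T` elements.
    have hfib : #D.offDiag ≤ T * #(latticeBox q κ N) := by
      refine card_le_mul_card_image_of_maps_to
        (f := fun p : ℕ × ℕ => ((p.1 : ℤ) ^ 2 - (p.2 : ℤ) ^ 2, σ p.1 - σ p.2)) ?_ T ?_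
      · intro p hp
        rw [mem_offDiag] at hp
        exact hbox _ hp.1 _ hp.2.1
      · intro w hw
        rcases (filter (fun p : ℕ × ℕ => ((p.1 : ℤ) ^ 2 - (p.2 : ℤ) ^ 2, σ p.1 - σ p.2) = w)
          D.offDiag).eq_empty_or_nonempty with h | ⟨p₀, hp₀⟩
        · simp [h]
        have hprod : ∀ p ∈ filter (fun p : ℕ × ℕ =>
            ((p.1 : ℤ) ^ 2 - (p.2 : ℤ) ^ 2, σ p.1 - σ p.2) = w) D.offDiag,
            ((p.1 : ℤ) - p.2) * (p.1 + p.2) = w.1 ∧ p.1 ≠ p.2 := by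
          intro p hp
          rw [mem_filter, mem_offDiag] at hp
          exact ⟨by rw [← hp.2]; ring, hp.1.2.2⟩
        have hw1 : w.1 ≠ 0 := by
          obtain ⟨h1, h2⟩ := hprod p₀ hp₀
          rw [← h1]
          have := sq_sub_sq_ne_zero h2
          intro h
          exact this (by linarith)
        have hw1N : w.1.natAbs ≤ N ^ 2 := by zify; exact (mem_latticeBox.1 hw).1
        refine le_trans ?_ (hT _ (Int.natAbs_ne_zero.2 hw1) hw1N)
        refine card_le_card_of_injOn (fun p => ((p.1 : ℤ) - p.2).natAbs) ?_ ?_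
        · intro p hp
          obtain ⟨h1, -⟩ := hprod p hp
          refine Nat.mem_divisors.2 ⟨?_, Int.natAbs_ne_zero.2 hw1⟩
          exact Int.natAbs_dvd_natAbs.2 ⟨_, h1.symm⟩
        · intro p hp p' hp' heq
          obtain ⟨h1, h1'⟩ := hprod p hp
          obtain ⟨h2, h2'⟩ := hprod p' hp'
          have hd0 : ((p.1 : ℤ) - p.2) ≠ 0 := sub_ne_zero.2 (by exact_mod_cast h1')
          rcases Int.natAbs_eq_natAbs_iff.1 heq with h | h
          · have h3 : ((p.1 : ℤ) + p.2) = p'.1 + p'.2 := by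
              refine mul_left_cancel₀ hd0 ?_
              rw [h1, h, h2]
            ext <;> omega
          · have h3 : ((p.1 : ℤ) + p.2) = -(p'.1 + p'.2) := by
              refine mul_left_cancel₀ hd0 ?_
              rw [h1, h, ← h2]; ring
            omega
    rw [offDiag_card] at hfib
    calc (#D * #D - #D) * q ≤ T * #(latticeBox q κ N) * q := Nat.mul_le_mul_right q hfib
      _ = T * (#(latticeBox q κ N) * q) := by ring
      _ ≤ T * (24 * N ^ 3) := Nat.mul_le_mul_left T hcard
      _ = _ := by ring

/-! ### Counting in the collinear case -/

/-- With `d₁` the least element, `s ∣ (d - d₁) (d + d₁)` splits `s = e f` with `e ∣ d - d₁` and `f ∣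
d + d₁`. Each splitting fixes `d` modulo `lcm(e, f) = s / gcd(e, f)`, and `(d - d₁) ^ 2 ≤ d ^ 2 - d₁
^ 2 ≤ s N / t` confines `d` to a short interval. -/
theorem card_le_sum_of_sq_congruent (D : Finset ℕ) (s t N : ℕ) (hs : 0 < s) (ht : 0 < t)
    (h : ∀ d ∈ D, ∀ d' ∈ D, (s : ℤ) ∣ (d : ℤ) ^ 2 - (d' : ℤ) ^ 2 ∧
      (t : ℤ) * ((d : ℤ) ^ 2 - (d' : ℤ) ^ 2) ≤ s * N) :
    (#D : ℝ) ≤ ∑ p ∈ s.divisorsAntidiagonal,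
      (√((s : ℝ) * N / t) * (p.1.gcd p.2 : ℝ) / s + 1) := by
  rcases D.eq_empty_or_nonempty with rfl | hne
  · simp only [card_empty, Nat.cast_zero]
    positivity
  set d₁ := D.min' hne with hd₁
  have hmem : d₁ ∈ D := D.min'_mem hne
  have hmin : ∀ d ∈ D, d₁ ≤ d := fun d hd => D.min'_le d hd
  set L := √((s : ℝ) * N / t) with hL
  have hcover : D ⊆ s.divisorsAntidiagonal.biUnion
      (fun p => D.filter (fun d => p.1 ∣ d - d₁ ∧ p.2 ∣ d + d₁)) := by
    intro d hd
    have h1 : s ∣ (d - d₁) * (d + d₁) := by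
      have := (h d hd d₁ hmem).1
      zify [hmin d hd]
      convert this using 1
      ring
    obtain ⟨e, f, he, hf, hef⟩ := exists_dvd_and_dvd_of_dvd_mul h1
    refine mem_biUnion.2 ⟨(e, f), Nat.mem_divisorsAntidiagonal.2 ⟨hef.symm, hs.ne'⟩, ?_⟩
    exact mem_filter.2 ⟨hd, he, hf⟩
  have hspan : ∀ d ∈ D, ((d - d₁ : ℕ) : ℝ) ≤ L := by
    intro d hd
    refine Real.le_sqrt_of_sq_le ?_
    rw [le_div_iff₀ (by exact_mod_cast ht)]
    have h1 := (h d hd d₁ hmem).2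
    have h2 : (((d - d₁ : ℕ) : ℤ)) ^ 2 * t ≤ s * N := by
      refine le_trans ?_ h1
      have h3 := hmin d hd
      push_cast [Nat.cast_sub h3]
      have h4 : (d₁ : ℤ) ≤ d := by exact_mod_cast h3
      have h5 : (0 : ℤ) ≤ d₁ := Int.natCast_nonneg _
      rw [mul_comm]
      gcongr
      nlinarith
    exact_mod_cast h2
  refine le_trans (Nat.cast_le.2 ((card_le_card hcover).trans card_biUnion_le)) ?_
  rw [Nat.cast_sum]
  refine sum_le_sum fun p hp => ?_
  obtain ⟨hpe, -⟩ := Nat.mem_divisorsAntidiagonal.1 hp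
  set l := p.1.lcm p.2 with hl
  have hgl : p.1.gcd p.2 * l = s := hpe ▸ Nat.gcd_mul_lcm _ _
  have hl0 : 0 < l := Nat.pos_of_ne_zero fun h0 => hs.ne' (by rw [← hgl, h0, mul_zero])
  have hcard : #(D.filter (fun d => p.1 ∣ d - d₁ ∧ p.2 ∣ d + d₁)) ≤ #(range (⌊L / l⌋₊ + 1)) := by
    refine card_le_card_of_injOn (fun d => (d - d₁) / l) ?_ ?_
    · intro d hd
      have hdD := (mem_filter.1 hd).1
      simp only [coe_range, Set.mem_Iio, Nat.lt_succ_iff]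
      refine Nat.le_floor (Nat.cast_div_le.trans ?_)
      gcongr
      exact hspan d hdD
    · intro d hd d' hd' heq
      obtain ⟨hdD, h1, h2⟩ := mem_filter.1 hd
      obtain ⟨hdD', h1', h2'⟩ := mem_filter.1 hd'
      have e1 : d - d₁ ≡ d' - d₁ [MOD p.1] :=
        ((Nat.modEq_zero_iff_dvd).2 h1).trans ((Nat.modEq_zero_iff_dvd).2 h1').symm
      have e2 : d - d₁ ≡ d' - d₁ [MOD p.2] := by
        have e3 : d + d₁ ≡ d' + d₁ [MOD p.2] :=
          ((Nat.modEq_zero_iff_dvd).2 h2).trans ((Nat.modEq_zero_iff_dvd).2 h2').symm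
        have e4 := Nat.ModEq.add_right_cancel' d₁ e3
        refine Nat.ModEq.add_right_cancel' d₁ ?_
        rwa [Nat.sub_add_cancel (hmin d hdD), Nat.sub_add_cancel (hmin d' hdD')]
      have e5 : (d - d₁) % l = (d' - d₁) % l := Nat.mod_lcm e1 e2
      have e6 : d - d₁ = d' - d₁ := by
        rw [← Nat.div_add_mod (d - d₁) l, ← Nat.div_add_mod (d' - d₁) l, e5,
          show (d - d₁) / l = (d' - d₁) / l from heq]
      have := hmin d hdD
      have := hmin d' hdD'
      omega
  have hdiv : L * (p.1.gcd p.2 : ℝ) / s = L / l := by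
    have hl0' : (l : ℝ) ≠ 0 := by exact_mod_cast hl0.ne'
    have hs0' : (s : ℝ) ≠ 0 := by exact_mod_cast hs.ne'
    rw [div_eq_div_iff hs0' hl0', ← hgl]
    push_cast; ring
  rw [hdiv]
  rw [card_range] at hcard
  calc _ ≤ ((⌊L / l⌋₊ + 1 : ℕ) : ℝ) := Nat.cast_le.2 hcard
    _ ≤ _ := by push_cast; gcongr; exact Nat.floor_le (by positivity)

/-- Writing the factors of `s` as `g x` and `g y` with `g` their gcd turns the summand into `1 / (x
y)`, where `g ≤ N` and `x, y ≤ N ^ 2`. -/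
theorem sum_gcd_sq_div_le (N : ℕ) :
    ∑ s ∈ Icc 1 (N ^ 2), ∑ p ∈ s.divisorsAntidiagonal, (p.1.gcd p.2 : ℝ) ^ 2 / s ≤
      N * (∑ k ∈ Icc 1 (N ^ 2), (1 : ℝ) / k) ^ 2 := by
  rw [sum_sigma']
  set S := (Icc 1 (N ^ 2)).sigma fun s => s.divisorsAntidiagonal with hS
  have hmem : ∀ x ∈ S, x.1 ≠ 0 ∧ x.1 ≤ N ^ 2 ∧ x.2.1 * x.2.2 = x.1 := by
    intro x hx
    rw [hS, mem_sigma, mem_Icc, Nat.mem_divisorsAntidiagonal] at hx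
    exact ⟨hx.2.2, hx.1.2, hx.2.1⟩
  set g : (Σ _ : ℕ, ℕ × ℕ) → ℕ × ℕ × ℕ :=
    fun x => (x.2.1.gcd x.2.2, x.2.1 / x.2.1.gcd x.2.2, x.2.2 / x.2.1.gcd x.2.2) with hg
  have hgpos : ∀ x ∈ S, 0 < x.2.1.gcd x.2.2 := by
    intro x hx
    obtain ⟨h0, -, h2⟩ := hmem x hx
    exact Nat.gcd_pos_of_pos_left _ (Nat.pos_of_ne_zero fun h => h0 (by rw [← h2, h, zero_mul]))
  have hrec1 : ∀ x ∈ S, (g x).1 * (g x).2.1 = x.2.1 := fun x _ =>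
    Nat.mul_div_cancel' (Nat.gcd_dvd_left _ _)
  have hrec2 : ∀ x ∈ S, (g x).1 * (g x).2.2 = x.2.2 := fun x _ =>
    Nat.mul_div_cancel' (Nat.gcd_dvd_right _ _)
  have hinj : Set.InjOn g S := by
    intro x hx y hy hxy
    have h1 : x.2.1 = y.2.1 := by rw [← hrec1 x hx, ← hrec1 y hy, hxy]
    have h2 : x.2.2 = y.2.2 := by rw [← hrec2 x hx, ← hrec2 y hy, hxy]
    have h3 : x.1 = y.1 := by rw [← (hmem x hx).2.2, ← (hmem y hy).2.2, h1, h2]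
    obtain ⟨x1, x2, x3⟩ := x
    obtain ⟨y1, y2, y3⟩ := y
    simp_all
  calc ∑ x ∈ S, (x.2.1.gcd x.2.2 : ℝ) ^ 2 / x.1
      = ∑ x ∈ S, (1 : ℝ) / (g x).2.1 * (1 / (g x).2.2) := by
        refine sum_congr rfl fun x hx => ?_
        have h0 : (x.1 : ℝ) ≠ 0 := by exact_mod_cast (hmem x hx).1
        have h1 : (x.1 : ℝ) = ((g x).1 * (g x).2.1) * ((g x).1 * (g x).2.2) := by
          have := (hmem x hx).2.2
          rw [← hrec1 x hx, ← hrec2 x hx] at this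
          exact_mod_cast this.symm
        have h2 : (x.2.1.gcd x.2.2 : ℝ) = (g x).1 := rfl
        rw [h1] at h0
        have a1 : ((g x).1 : ℝ) ≠ 0 := fun h => h0 (by rw [h]; ring)
        have a2 : ((g x).2.1 : ℝ) ≠ 0 := fun h => h0 (by rw [h]; ring)
        have a3 : ((g x).2.2 : ℝ) ≠ 0 := fun h => h0 (by rw [h]; ring)
        rw [h1, h2]
        field_simp
    _ = ∑ y ∈ S.image g, (1 : ℝ) / y.2.1 * (1 / y.2.2) :=
        (sum_image (f := fun y : ℕ × ℕ × ℕ => (1 : ℝ) / y.2.1 * (1 / y.2.2)) hinj).symm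
    _ ≤ ∑ y ∈ Icc 1 N ×ˢ Icc 1 (N ^ 2) ×ˢ Icc 1 (N ^ 2), (1 : ℝ) / y.2.1 * (1 / y.2.2) := by
        refine sum_le_sum_of_subset_of_nonneg ?_ fun _ _ _ => by positivity
        intro y hy
        obtain ⟨x, hx, rfl⟩ := mem_image.1 hy
        obtain ⟨h0, hN, hmul⟩ := hmem x hx
        have hprod : ((g x).1 * (g x).2.1) * ((g x).1 * (g x).2.2) = x.1 := by
          rw [hrec1 x hx, hrec2 x hx, hmul]
        have b1 : 0 < (g x).1 := hgpos x hx
        have b2 : 0 < (g x).2.1 := Nat.pos_of_ne_zero fun h => h0 (by rw [← hprod, h]; ring)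
        have b3 : 0 < (g x).2.2 := Nat.pos_of_ne_zero fun h => h0 (by rw [← hprod, h]; ring)
        have hle : ((g x).1 ^ 2 * ((g x).2.1 * (g x).2.2)) ≤ N ^ 2 := by
          calc _ = x.1 := by rw [← hprod]; ring
            _ ≤ _ := hN
        simp only [mem_product, mem_Icc]
        refine ⟨⟨b1, ?_⟩, ⟨b2, ?_⟩, b3, ?_⟩
        · refine (Nat.pow_le_pow_iff_left (n := 2) (by norm_num)).1 ?_
          exact (Nat.le_mul_of_pos_right _ (Nat.mul_pos b2 b3)).trans hle
        · refine le_trans ?_ hle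
          calc (g x).2.1 ≤ (g x).2.1 * ((g x).1 ^ 2 * (g x).2.2) :=
                Nat.le_mul_of_pos_right _ (by positivity)
            _ = _ := by ring
        · refine le_trans ?_ hle
          calc (g x).2.2 ≤ (g x).2.2 * ((g x).1 ^ 2 * (g x).2.1) :=
                Nat.le_mul_of_pos_right _ (by positivity)
            _ = _ := by ring
    _ = _ := by
        rw [sum_product]
        simp only [sum_const, Nat.card_Icc, nsmul_eq_mul, Nat.add_sub_cancel]
        rw [sum_product, sq (∑ k ∈ Icc 1 (N ^ 2), (1 : ℝ) / k), sum_mul_sum]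

/-! ### Additive energy of modular square roots -/

/-- The residues `u` such that `u ^ 2 = j m` for some `m ∼ N`. -/
def rootSet (q : ℕ) [NeZero q] (j : ZMod q) (N : ℕ) : Finset (ZMod q) :=
  univ.filter fun u => ∃ m ∈ dyadicInterval N, u ^ 2 = j * m

/-- The number of representations of `l` as a difference of two elements of `A`. -/
def diffCount {q : ℕ} (A : Finset (ZMod q)) (l : ZMod q) : ℕ :=
  #((A ×ˢ A).filter fun p => p.1 - p.2 = l)

theorem mem_dyadicInterval {m N : ℕ} : m ∈ dyadicInterval N ↔ m < N ∧ N ≤ 2 * m := by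
  simp [dyadicInterval]

theorem card_dyadicInterval_le (N : ℕ) : #(dyadicInterval N) ≤ N := by
  simpa [dyadicInterval] using card_filter_le (range N) fun m => N ≤ 2 * m

theorem card_sq_eq_le_two {q : ℕ} [Fact q.Prime] (c : ZMod q) :
    #(univ.filter fun u : ZMod q => u ^ 2 = c) ≤ 2 := by
  rcases (univ.filter fun u : ZMod q => u ^ 2 = c).eq_empty_or_nonempty with h | ⟨u, hu⟩
  · simp [h]
  · refine (card_le_card fun v hv => ?_).trans (card_le_two (a := u) (b := -u))
    rw [mem_filter] at hu hv
    rw [mem_insert, mem_singleton]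
    exact sq_eq_sq_iff_eq_or_eq_neg.1 (hv.2.trans hu.2.symm)

theorem card_rootSet_le {q : ℕ} [Fact q.Prime] (j : ZMod q) (N : ℕ) :
    #(rootSet q j N) ≤ 2 * N := by
  have h : rootSet q j N ⊆
      (dyadicInterval N).biUnion fun m => univ.filter fun u : ZMod q => u ^ 2 = j * m := by
    intro u hu
    obtain ⟨m, hm, hum⟩ := (mem_filter.1 hu).2
    exact mem_biUnion.2 ⟨m, hm, by simpa using hum⟩
  calc _ ≤ _ := card_le_card h
    _ ≤ _ := card_biUnion_le_card_mul _ _ 2 fun m _ => card_sq_eq_le_two _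
    _ ≤ N * 2 := Nat.mul_le_mul_right 2 (card_dyadicInterval_le N)
    _ = _ := mul_comm _ _

theorem sum_diffCount {q : ℕ} [NeZero q] (A : Finset (ZMod q)) :
    ∑ l, diffCount A l = #A ^ 2 := by
  rw [sq, ← card_product]
  exact (card_eq_sum_card_fiberwise fun _ _ => mem_coe.2 (mem_univ _)).symm

/-- The differences `|m - n|`, for `u ^ 2 = j m`, `v ^ 2 = j n` and `u - v = l`, are abscissas of
points on a parabola. -/
theorem exists_parabola {q : ℕ} [Fact q.Prime] (h2 : (2 : ZMod q) ≠ 0) {j l : ZMod q} (hj : j ≠ 0)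
    (hl : l ≠ 0) (N : ℕ) :
    ∃ (D : Finset ℕ) (σ : ℕ → ℤ), (∀ d ∈ D, d < N) ∧ (∀ d ∈ D, ∀ d' ∈ D, |σ d - σ d'| ≤ N) ∧
      (∀ d ∈ D, (d : ZMod q) ^ 2 = 2 * l ^ 2 / j * (σ d : ZMod q) - (l ^ 2 / j) ^ 2) ∧
      diffCount (rootSet q j N) l ≤ 2 * #D := by
  have hex : ∀ u : ZMod q, ∃ m : ℕ, u ∈ rootSet q j N → m ∈ dyadicInterval N ∧ u ^ 2 = j * m := by
    intro u
    by_cases hu : u ∈ rootSet q j N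
    · obtain ⟨m, hm⟩ := (mem_filter.1 hu).2
      exact ⟨m, fun _ => hm⟩
    · exact ⟨0, fun h => absurd h hu⟩
  choose m hm using hex
  set S := (rootSet q j N ×ˢ rootSet q j N).filter fun p => p.1 - p.2 = l with hS
  have hSm : ∀ p ∈ S, (m p.1 ∈ dyadicInterval N ∧ p.1 ^ 2 = j * m p.1) ∧
      (m p.2 ∈ dyadicInterval N ∧ p.2 ^ 2 = j * m p.2) ∧ p.1 - p.2 = l := by
    intro p hp
    rw [hS, mem_filter, mem_product] at hp
    exact ⟨hm _ hp.1.1, hm _ hp.1.2, hp.2⟩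
  set f : ZMod q × ZMod q → ℕ := fun p => ((m p.1 : ℤ) - m p.2).natAbs with hf
  have hσ : ∀ d : ℕ, ∃ p, d ∈ S.image f → p ∈ S ∧ f p = d := by
    intro d
    by_cases hd : d ∈ S.image f
    · obtain ⟨p, hp⟩ := mem_image.1 hd
      exact ⟨p, fun _ => hp⟩
    · exact ⟨0, fun h => absurd h hd⟩
  choose P hP using hσ
  -- The ordinate is `m + n` for one chosen pair. Eliminating `u + v` from `j (m - n) = l (u + v)`
  -- and `2 j (m + n) = (u + v) ^ 2 + l ^ 2` gives the parabola.
  refine ⟨S.image f, fun d => (m (P d).1 : ℤ) + m (P d).2, ?_, ?_, ?_, ?_⟩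
  · intro d hd
    obtain ⟨p, hp, rfl⟩ := mem_image.1 hd
    obtain ⟨⟨h1, -⟩, ⟨h2, -⟩, -⟩ := hSm p hp
    rw [mem_dyadicInterval] at h1 h2
    simp only [hf]; omega
  · intro d hd d' hd'
    obtain ⟨⟨h1, -⟩, ⟨h2, -⟩, -⟩ := hSm _ (hP d hd).1
    obtain ⟨⟨h3, -⟩, ⟨h4, -⟩, -⟩ := hSm _ (hP d' hd').1
    rw [mem_dyadicInterval] at h1 h2 h3 h4
    rw [abs_le]; constructor <;> dsimp only <;> omega
  · intro d hd
    obtain ⟨⟨-, h1⟩, ⟨-, h2⟩, h3⟩ := hSm _ (hP d hd).1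
    have hd2 : (d : ZMod q) ^ 2 = ((m (P d).1 : ZMod q) - m (P d).2) ^ 2 := by
      have : ((d : ℤ)) ^ 2 = ((m (P d).1 : ℤ) - m (P d).2) ^ 2 := by
        conv_lhs => rw [← (hP d hd).2]
        exact Int.natAbs_sq _
      exact_mod_cast congrArg (Int.cast : ℤ → ZMod q) this
    rw [hd2]
    push_cast
    have e1 : (m (P d).1 : ZMod q) = (P d).1 ^ 2 / j := by rw [h1]; field_simp
    have e2 : (m (P d).2 : ZMod q) = (P d).2 ^ 2 / j := by rw [h2]; field_simp
    rw [e1, e2, ← h3]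
    field_simp
    ring
  -- The factor 2 is the sign of `m - n`; the signed difference determines `u + v`, hence `u` and
  -- `v`.
  · refine card_le_mul_card_image (f := f) S 2 fun d hd => ?_
    refine (card_le_card_of_injOn (t := ({(d : ℤ), -(d : ℤ)} : Finset ℤ))
      (fun p => (m p.1 : ℤ) - m p.2) ?_ ?_).trans card_le_two
    · intro p hp
      have := (mem_filter.1 hp).2
      simp only [hf] at this
      simp only [coe_insert, coe_singleton, Set.mem_insert_iff, Set.mem_singleton_iff]
      omega
    · intro p hp p' hp' heq
      obtain ⟨⟨-, h1⟩, ⟨-, h3⟩, h4⟩ := hSm p (mem_filter.1 hp).1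
      obtain ⟨⟨-, h1'⟩, ⟨-, h3'⟩, h4'⟩ := hSm p' (mem_filter.1 hp').1
      have h5 : (m p.1 : ZMod q) - m p.2 = m p'.1 - m p'.2 := by
        exact_mod_cast congrArg (Int.cast : ℤ → ZMod q) heq
      have h6 : l * (p.1 + p.2) = l * (p'.1 + p'.2) := by
        calc l * (p.1 + p.2) = p.1 ^ 2 - p.2 ^ 2 := by rw [← h4]; ring
          _ = p'.1 ^ 2 - p'.2 ^ 2 := by rw [h1, h3, h1', h3', ← mul_sub, h5, mul_sub]
          _ = _ := by rw [← h4']; ring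
      have h7 := mul_left_cancel₀ hl h6
      have h8 : p.1 = p'.1 := mul_left_cancel₀ h2 (by linear_combination h7 + h4 - h4')
      refine Prod.ext h8 ?_
      rw [h8] at h7
      exact add_left_cancel h7

/-- The bound for the number of solutions in the collinear case. -/
noncomputable def collinearBound (N s t : ℕ) : ℝ :=
  ∑ p ∈ s.divisorsAntidiagonal, √((s : ℝ) * N / t) * (p.1.gcd p.2 : ℝ) / s

theorem collinearBound_nonneg (N s t : ℕ) : 0 ≤ collinearBound N s t :=
  sum_nonneg fun _ _ => by positivity

/-- Cauchy–Schwarz over the at most `T` factorizations of `s`. -/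
theorem collinearBound_sq_le {N s t T : ℕ} (hs : s ≠ 0) (hT : #s.divisors ≤ T) :
    collinearBound N s t ^ 2 ≤
      T * N * ((1 : ℝ) / t) * ∑ p ∈ s.divisorsAntidiagonal, (p.1.gcd p.2 : ℝ) ^ 2 / s := by
  have hs' : (s : ℝ) ≠ 0 := by exact_mod_cast hs
  have hcard : #s.divisorsAntidiagonal = #s.divisors := by
    rw [← Nat.map_div_right_divisors, card_map]
  have hterm : ∀ p : ℕ × ℕ, (√((s : ℝ) * N / t) * (p.1.gcd p.2 : ℝ) / s) ^ 2 =
      N * ((1 : ℝ) / t) * ((p.1.gcd p.2 : ℝ) ^ 2 / s) := by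
    intro p
    rw [div_pow, mul_pow, Real.sq_sqrt (by positivity)]
    field_simp
  calc collinearBound N s t ^ 2
      ≤ #s.divisorsAntidiagonal * ∑ p ∈ s.divisorsAntidiagonal,
          (√((s : ℝ) * N / t) * (p.1.gcd p.2 : ℝ) / s) ^ 2 := sq_sum_le_card_mul_sum_sq
    _ = #s.divisors * (N * ((1 : ℝ) / t) *
          ∑ p ∈ s.divisorsAntidiagonal, (p.1.gcd p.2 : ℝ) ^ 2 / s) := by
        rw [hcard]; simp only [hterm, mul_sum]
    _ ≤ T * (N * ((1 : ℝ) / t) *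
          ∑ p ∈ s.divisorsAntidiagonal, (p.1.gcd p.2 : ℝ) ^ 2 / s) := by gcongr
    _ = _ := by ring

theorem sum_collinearBound_sq_le {N T : ℕ}
    (hT : ∀ n, n ≠ 0 → n ≤ N ^ 2 → #n.divisors ≤ T) :
    ∑ s ∈ Icc 1 (N ^ 2), ∑ t ∈ Icc 1 N, collinearBound N s t ^ 2 ≤
      T * (N : ℝ) ^ 2 * (∑ k ∈ Icc 1 (N ^ 2), (1 : ℝ) / k) ^ 3 := by
  have hsub : ∑ t ∈ Icc 1 N, (1 : ℝ) / t ≤ ∑ k ∈ Icc 1 (N ^ 2), (1 : ℝ) / k :=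
    sum_le_sum_of_subset_of_nonneg
      (Icc_subset_Icc_right (Nat.le_self_pow (by norm_num) N)) fun _ _ _ => by positivity
  calc _ ≤ ∑ s ∈ Icc 1 (N ^ 2), ∑ t ∈ Icc 1 N, T * N * ((1 : ℝ) / t) *
          ∑ p ∈ s.divisorsAntidiagonal, (p.1.gcd p.2 : ℝ) ^ 2 / s := by
        refine sum_le_sum fun s hs => sum_le_sum fun t _ => ?_
        obtain ⟨h1, h2⟩ := mem_Icc.1 hs
        exact collinearBound_sq_le (by omega) (hT s (by omega) h2)
    _ = T * N * (∑ t ∈ Icc 1 N, (1 : ℝ) / t) *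
          ∑ s ∈ Icc 1 (N ^ 2), ∑ p ∈ s.divisorsAntidiagonal, (p.1.gcd p.2 : ℝ) ^ 2 / s := by
        rw [mul_sum]
        refine sum_congr rfl fun s _ => ?_
        rw [← sum_mul, ← mul_sum]
    _ ≤ T * N * (∑ k ∈ Icc 1 (N ^ 2), (1 : ℝ) / k) *
          (N * (∑ k ∈ Icc 1 (N ^ 2), (1 : ℝ) / k) ^ 2) := by
        gcongr
        exact sum_gcd_sq_div_le N
    _ = _ := by ring

/-- Shaped for summation over `l`. The linear term covers every case but a large collinear one.
There the direction `(s, t)`, which depends on `l`, is replaced by a sum over all compatible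
directions so that the summations can be exchanged. -/
theorem diffCount_sq_le {q : ℕ} [Fact q.Prime] (h2 : (2 : ZMod q) ≠ 0) {j l : ZMod q}
    (hj : j ≠ 0) (hl : l ≠ 0) {N T : ℕ} (hN : 0 < N) (hNq : 2 * N ≤ q)
    (hT : ∀ n, n ≠ 0 → n ≤ N ^ 2 → #n.divisors ≤ T) :
    (diffCount (rootSet q j N) l : ℝ) ^ 2 ≤
      14 * T * (1 + √((N : ℝ) ^ 3 / q)) * diffCount (rootSet q j N) l +
      16 * ∑ s ∈ Icc 1 (N ^ 2), ∑ t ∈ Icc 1 N,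
        if 2 * l ^ 2 / j * (t : ZMod q) = s ∨ 2 * l ^ 2 / j * (t : ZMod q) = -s then
          collinearBound N s t ^ 2 else 0 := by
  obtain ⟨D, σ, hD, hσ, hpar, hr⟩ := exists_parabola h2 hj hl N
  set r := diffCount (rootSet q j N) l
  have hκ : 2 * l ^ 2 / j ≠ 0 := div_ne_zero (mul_ne_zero h2 (pow_ne_zero 2 hl)) hj
  have hr' : (r : ℝ) ≤ 2 * #D := by exact_mod_cast hr
  have hr0 : (0 : ℝ) ≤ r := Nat.cast_nonneg r
  have hT1 : (1 : ℝ) ≤ T := by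
    have := hT 1 one_ne_zero (Nat.one_le_pow _ _ hN)
    simp only [Nat.divisors_one, card_singleton] at this
    exact_mod_cast this
  set ρ := √((N : ℝ) ^ 3 / q) with hρ
  have hρ0 : 0 ≤ ρ := Real.sqrt_nonneg _
  have hnn : ∀ s ∈ Icc 1 (N ^ 2), ∀ t ∈ Icc 1 N, (0 : ℝ) ≤
      if 2 * l ^ 2 / j * (t : ZMod q) = s ∨ 2 * l ^ 2 / j * (t : ZMod q) = -s then
        collinearBound N s t ^ 2 else 0 := by
    intro s _ t _
    split_ifs <;> positivity
  have hsum0 := sum_nonneg fun s hs => sum_nonneg (hnn s hs)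
  have hTρ : 0 ≤ (T : ℝ) * ρ := by positivity
  have hsmall : ∀ c : ℝ, (r : ℝ) ≤ c → c ≤ 14 * T * (1 + ρ) →
      (r : ℝ) ^ 2 ≤ 14 * T * (1 + ρ) * r := by
    intro c h1 h2
    rw [sq]
    exact mul_le_mul_of_nonneg_right (h1.trans h2) hr0
  rcases le_or_gt (#D) 1 with hD1 | hD1
  · have : (#D : ℝ) ≤ 1 := by exact_mod_cast hD1
    have := hsmall 2 (by linarith) (by nlinarith)
    linarith
  rcases parabola_card_le_or_collinear hκ hN hNq D σ hD hσ hpar hT with h | h | h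
  · omega
  · have hq0 : (0 : ℝ) < q := by exact_mod_cast (Fact.out : q.Prime).pos
    have h3 : #D * #D * q ≤ 48 * T * N ^ 3 := by
      have h4 : #D * #D ≤ 2 * (#D * #D - #D) := by
        have : 2 * #D ≤ #D * #D := Nat.mul_le_mul_right _ hD1
        omega
      calc #D * #D * q ≤ 2 * (#D * #D - #D) * q := Nat.mul_le_mul_right q h4
        _ = 2 * ((#D * #D - #D) * q) := by ring
        _ ≤ 2 * (24 * T * N ^ 3) := Nat.mul_le_mul_left 2 h
        _ = _ := by ring
    -- `48 ≤ 7 ^ 2`, and `T ≤ T ^ 2`.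
    have h5 : (#D : ℝ) ^ 2 ≤ (7 * T * ρ) ^ 2 := by
      have h6 : (#D : ℝ) * #D * q ≤ 48 * T * N ^ 3 := by exact_mod_cast h3
      have h7 : ρ ^ 2 = (N : ℝ) ^ 3 / q := Real.sq_sqrt (by positivity)
      rw [mul_pow, h7, mul_div_assoc', le_div_iff₀ hq0, sq]
      refine h6.trans ?_
      gcongr
      nlinarith
    have h8 : (#D : ℝ) ≤ 7 * T * ρ := abs_le_of_sq_le_sq' h5 (by positivity) |>.2
    have := hsmall (2 * (7 * T * ρ)) (by linarith) (by nlinarith)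
    linarith
  · obtain ⟨s, hs, t, ht, hst, hcol⟩ := h
    obtain ⟨hs1, hsN⟩ := mem_Icc.1 hs
    have hb := card_le_sum_of_sq_congruent D s t N hs1 (mem_Icc.1 ht).1 hcol
    have hcard : #s.divisorsAntidiagonal = #s.divisors := by
      rw [← Nat.map_div_right_divisors, card_map]
    rw [sum_add_distrib, sum_const, hcard, nsmul_eq_mul, mul_one] at hb
    change (#D : ℝ) ≤ collinearBound N s t + _ at hb
    have hτ : (#s.divisors : ℝ) ≤ T := by exact_mod_cast hT s (by omega) hsN
    have hb0 := collinearBound_nonneg N s t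
    have hle : collinearBound N s t ^ 2 ≤ ∑ s ∈ Icc 1 (N ^ 2), ∑ t ∈ Icc 1 N,
        if 2 * l ^ 2 / j * (t : ZMod q) = s ∨ 2 * l ^ 2 / j * (t : ZMod q) = -s then
          collinearBound N s t ^ 2 else 0 := by
      refine le_trans ?_ (single_le_sum (fun s hs => sum_nonneg (hnn s hs)) hs)
      refine le_trans ?_ (single_le_sum (hnn s hs) ht)
      rw [if_pos hst]
    -- If the rounding terms, at most `T` in total, dominate, the linear term suffices; otherwise `r
    -- ≤ 4 * collinearBound N s t`.
    rcases le_total (collinearBound N s t) T with hbT | hbT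
    · have := hsmall (4 * T) (by linarith) (by nlinarith)
      linarith
    · have h9 : (r : ℝ) ≤ 4 * collinearBound N s t := by linarith
      have h10 : (r : ℝ) ^ 2 ≤ (4 * collinearBound N s t) ^ 2 := by gcongr
      have h11 : 0 ≤ 14 * T * (1 + ρ) * r := by positivity
      linarith [mul_pow (4 : ℝ) (collinearBound N s t) 2]

theorem card_sq_eq_mul_le {q : ℕ} [Fact q.Prime] (h2 : (2 : ZMod q) ≠ 0) {j : ZMod q}
    (hj : j ≠ 0) {t : ZMod q} (ht : t ≠ 0) (s : ZMod q) :
    #(univ.filter fun l : ZMod q => 2 * l ^ 2 / j * t = s ∨ 2 * l ^ 2 / j * t = -s) ≤ 4 := by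
  have h : (univ.filter fun l : ZMod q => 2 * l ^ 2 / j * t = s ∨ 2 * l ^ 2 / j * t = -s) ⊆
      (univ.filter fun l : ZMod q => l ^ 2 = s * j / (2 * t)) ∪
        (univ.filter fun l : ZMod q => l ^ 2 = -s * j / (2 * t)) := by
    intro l hl
    simp only [mem_filter, mem_union, mem_univ, true_and] at hl ⊢
    refine hl.imp (fun h => ?_) (fun h => ?_) <;>
    · rw [← h]; field_simp
  calc _ ≤ _ := card_le_card h
    _ ≤ _ := card_union_le _ _
    _ ≤ 2 + 2 := Nat.add_le_add (card_sq_eq_le_two _) (card_sq_eq_le_two _)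

/-- The additive energy of the set of modular square roots. -/
theorem sum_diffCount_sq_le {q : ℕ} [Fact q.Prime] (h2 : (2 : ZMod q) ≠ 0) {j : ZMod q}
    (hj : j ≠ 0) {N T : ℕ} (hN : 0 < N) (hNq : 2 * N ≤ q)
    (hT : ∀ n, n ≠ 0 → n ≤ N ^ 2 → #n.divisors ≤ T) :
    ∑ l, (diffCount (rootSet q j N) l : ℝ) ^ 2 ≤
      124 * T * (∑ k ∈ Icc 1 (N ^ 2), (1 : ℝ) / k) ^ 3 *
        ((N : ℝ) ^ 2 * (1 + √((N : ℝ) ^ 3 / q))) := by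
  set A := rootSet q j N
  set H := ∑ k ∈ Icc 1 (N ^ 2), (1 : ℝ) / k
  set ρ := √((N : ℝ) ^ 3 / q) with hρ
  have hρ0 : 0 ≤ ρ := Real.sqrt_nonneg _
  have hH1 : 1 ≤ H := by
    have := single_le_sum (f := fun k : ℕ => (1 : ℝ) / k) (fun _ _ => by positivity)
      (mem_Icc.2 ⟨le_rfl, Nat.one_le_pow 2 N hN⟩)
    simpa [H] using this
  have hT1 : (1 : ℝ) ≤ T := by
    have := hT 1 one_ne_zero (Nat.one_le_pow _ _ hN)
    simp only [Nat.divisors_one, card_singleton] at this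
    exact_mod_cast this
  have hA : (#A : ℝ) ≤ 2 * N := by exact_mod_cast card_rootSet_le j N
  have hsumr : ∑ l, (diffCount A l : ℝ) ≤ 4 * (N : ℝ) ^ 2 := by
    have : ∑ l, (diffCount A l : ℝ) = (#A : ℝ) ^ 2 := by exact_mod_cast sum_diffCount A
    rw [this]
    nlinarith [Nat.cast_nonneg (α := ℝ) #A]
  have hzero : (diffCount A 0 : ℝ) ^ 2 ≤ 4 * (N : ℝ) ^ 2 := by
    have h1 : diffCount A 0 ≤ #A := by
      refine card_le_card_of_injOn Prod.fst (fun p hp => ?_) ?_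
      · exact (mem_product.1 (mem_filter.1 hp).1).1
      · intro p hp p' hp' h
        have e1 := sub_eq_zero.1 (mem_filter.1 hp).2
        have e2 := sub_eq_zero.1 (mem_filter.1 hp').2
        exact Prod.ext h (by rw [← e1, ← e2, h])
    have h2 : (diffCount A 0 : ℝ) ≤ 2 * N := (Nat.cast_le.2 h1).trans hA
    calc (diffCount A 0 : ℝ) ^ 2 ≤ (2 * N) ^ 2 := by gcongr
      _ = _ := by ring
  -- With the summations exchanged, `(s, t)` fixes `l ^ 2` up to sign and so admits at most four
  -- `l`.
  have hcoll : ∑ l : ZMod q, ∑ s ∈ Icc 1 (N ^ 2), ∑ t ∈ Icc 1 N,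
      (if 2 * l ^ 2 / j * (t : ZMod q) = s ∨ 2 * l ^ 2 / j * (t : ZMod q) = -s then
        collinearBound N s t ^ 2 else 0) ≤ 4 * (T * (N : ℝ) ^ 2 * H ^ 3) := by
    rw [sum_comm]
    simp_rw [sum_comm (s := (univ : Finset (ZMod q)))]
    refine le_trans ?_ (mul_le_mul_of_nonneg_left (sum_collinearBound_sq_le hT) (by norm_num))
    rw [mul_sum]
    refine sum_le_sum fun s _ => ?_
    rw [mul_sum]
    refine sum_le_sum fun t ht => ?_
    rw [← sum_filter, sum_const, nsmul_eq_mul]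
    refine mul_le_mul_of_nonneg_right ?_ (sq_nonneg _)
    obtain ⟨ht1, htN⟩ := mem_Icc.1 ht
    exact_mod_cast card_sq_eq_mul_le h2 hj (natCast_zmod_ne_zero (q := q) ht1 (by omega)) s
  have hpt : ∀ l : ZMod q, (diffCount A l : ℝ) ^ 2 ≤
      (if l = 0 then 4 * (N : ℝ) ^ 2 else 0) + (14 * T * (1 + ρ) * diffCount A l +
      16 * ∑ s ∈ Icc 1 (N ^ 2), ∑ t ∈ Icc 1 N,
        if 2 * l ^ 2 / j * (t : ZMod q) = s ∨ 2 * l ^ 2 / j * (t : ZMod q) = -s then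
          collinearBound N s t ^ 2 else 0) := by
    intro l
    by_cases hl : l = 0
    · rw [if_pos hl]
      have h3 : (0 : ℝ) ≤ ∑ s ∈ Icc 1 (N ^ 2), ∑ t ∈ Icc 1 N,
        if 2 * l ^ 2 / j * (t : ZMod q) = s ∨ 2 * l ^ 2 / j * (t : ZMod q) = -s then
          collinearBound N s t ^ 2 else 0 :=
        sum_nonneg fun _ _ => sum_nonneg fun _ _ => by split_ifs <;> positivity
      have h4 : 0 ≤ 14 * T * (1 + ρ) * diffCount A l := by positivity
      rw [← hl] at hzero
      linarith
    · rw [if_neg hl, zero_add]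
      exact diffCount_sq_le h2 hj hl hN hNq hT
  calc ∑ l, (diffCount A l : ℝ) ^ 2 ≤ _ := sum_le_sum fun l _ => hpt l
    _ ≤ 4 * (N : ℝ) ^ 2 + (14 * T * (1 + ρ) * (4 * (N : ℝ) ^ 2) +
          16 * (4 * (T * (N : ℝ) ^ 2 * H ^ 3))) := by
        rw [sum_add_distrib, sum_add_distrib, ← mul_sum, ← mul_sum, sum_ite_eq' univ (0 : ZMod q),
          if_pos (mem_univ _)]
        gcongr
    -- `124 = 4 + 14 * 4 + 16 * 4`.
    _ ≤ _ := by
        have hH3 : 1 ≤ H ^ 3 := one_le_pow₀ hH1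
        have hX : 0 ≤ (N : ℝ) ^ 2 := by positivity
        have e1 : (N : ℝ) ^ 2 ≤ T * H ^ 3 * ((N : ℝ) ^ 2 * (1 + ρ)) := by
          have : 1 ≤ T * H ^ 3 * (1 + ρ) :=
            one_le_mul_of_one_le_of_one_le (one_le_mul_of_one_le_of_one_le hT1 hH3) (by linarith)
          nlinarith
        have e2 : T * (N : ℝ) ^ 2 * (1 + ρ) ≤ T * H ^ 3 * ((N : ℝ) ^ 2 * (1 + ρ)) := by
          have : 0 ≤ T * (N : ℝ) ^ 2 * (1 + ρ) := by positivity
          nlinarith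
        have e3 : T * (N : ℝ) ^ 2 * H ^ 3 ≤ T * H ^ 3 * ((N : ℝ) ^ 2 * (1 + ρ)) := by
          have : 0 ≤ T * (N : ℝ) ^ 2 * H ^ 3 := by positivity
          nlinarith
        linarith

theorem exists_energy_bound (δ : ℝ) (hδ : 0 < δ) :
    ∃ C : ℝ, 1 ≤ C ∧ ∀ (q : ℕ) [Fact q.Prime], (2 : ZMod q) ≠ 0 → ∀ j : ZMod q, j ≠ 0 →
      ∀ N : ℕ, 0 < N → 2 * N ≤ q →
        ∑ l, (diffCount (rootSet q j N) l : ℝ) ^ 2 ≤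
          C * (q : ℝ) ^ δ * ((N : ℝ) ^ 2 * (1 + √((N : ℝ) ^ 3 / q))) := by
  -- Arguments reach `N ^ 2 ≤ q ^ 2`, so each use costs `q ^ (δ / 4)`; one divisor factor and three
  -- harmonic factors make `q ^ δ`.
  obtain ⟨C₁, hC₁, hdiv⟩ := exists_card_divisors_le (δ / 8) (by linarith)
  obtain ⟨C₂, hC₂, hharm⟩ := exists_sum_inv_le (δ / 8) (by linarith)
  have hCC : 1 ≤ C₁ * C₂ ^ 3 := one_le_mul_of_one_le_of_one_le hC₁ (one_le_pow₀ hC₂)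
  refine ⟨124 * (C₁ * C₂ ^ 3), by linarith, fun q _ h2 j hj N hN hNq => ?_⟩
  have hq0 : (0 : ℝ) ≤ q := Nat.cast_nonneg q
  have hpow : ∀ n : ℕ, n ≤ N ^ 2 → (n : ℝ) ^ (δ / 8) ≤ (q : ℝ) ^ (δ / 4) := by
    intro n hn
    have h1 : (n : ℝ) ≤ (q : ℝ) ^ (2 : ℝ) := by
      rw [Real.rpow_two]
      have : n ≤ q ^ 2 := hn.trans (Nat.pow_le_pow_left (by omega) 2)
      exact_mod_cast this
    calc (n : ℝ) ^ (δ / 8) ≤ ((q : ℝ) ^ (2 : ℝ)) ^ (δ / 8) :=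
          Real.rpow_le_rpow (Nat.cast_nonneg n) h1 (by linarith)
      _ = _ := by rw [← Real.rpow_mul hq0]; congr 1; ring
  set Q := (q : ℝ) ^ (δ / 4) with hQ
  have hQ0 : 0 ≤ Q := Real.rpow_nonneg hq0 _
  have hT : ∀ n, n ≠ 0 → n ≤ N ^ 2 → #n.divisors ≤ ⌊C₁ * Q⌋₊ := by
    intro n hn hnN
    refine Nat.le_floor ((hdiv n hn).trans ?_)
    gcongr
    exact hpow n hnN
  have hH : ∑ k ∈ Icc 1 (N ^ 2), (1 : ℝ) / k ≤ C₂ * Q := by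
    refine (hharm _ (pow_ne_zero 2 hN.ne')).trans ?_
    gcongr
    exact hpow _ le_rfl
  refine (sum_diffCount_sq_le h2 hj hN hNq hT).trans ?_
  refine mul_le_mul_of_nonneg_right ?_ (by positivity)
  have hQ4 : (q : ℝ) ^ δ = Q ^ 4 := by
    rw [hQ, ← Real.rpow_natCast, ← Real.rpow_mul hq0]; congr 1; push_cast; ring
  calc _ ≤ 124 * (C₁ * Q) * (C₂ * Q) ^ 3 := by
        gcongr
        exact Nat.floor_le (by positivity)
    _ = _ := by rw [hQ4]; ring

/-! ### Bilinear exponential sums via additive energy -/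

section Bilinear

variable {q : ℕ} [Fact q.Prime]

open ZMod

theorem sum_stdAddChar_mul (b : ZMod q) :
    ∑ x : ZMod q, stdAddChar (x * b) = if b = 0 then (q : ℂ) else 0 := by
  have := AddChar.sum_mulShift b (isPrimitive_stdAddChar q)
  rw [this, ZMod.card]
  split_ifs <;> simp

theorem normSq_sum_stdAddChar {ι : Type*} (s : Finset ι) (c : ι → ℂ) (y : ι → ZMod q) :
    ((‖∑ i ∈ s, c i * stdAddChar (y i)‖ ^ 2 : ℝ) : ℂ) =
      ∑ i ∈ s, ∑ k ∈ s, c i * (starRingEnd ℂ) (c k) * stdAddChar (y i - y k) := by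
  push_cast
  rw [← Complex.mul_conj', map_sum, sum_mul_sum]
  refine sum_congr rfl fun i _ => sum_congr rfl fun k _ => ?_
  rw [map_mul, ← AddChar.map_neg_eq_conj, sub_eq_add_neg, AddChar.map_add_eq_mul]
  ring

theorem sum_norm_sq_stdAddChar {h : ZMod q} (hh : h ≠ 0) (c : ZMod q → ℂ) :
    ∑ l : ZMod q, ‖∑ u, c u * stdAddChar (l * (h * u))‖ ^ 2 = q * ∑ u, ‖c u‖ ^ 2 := by
  have key : ((∑ l : ZMod q, ‖∑ u, c u * stdAddChar (l * (h * u))‖ ^ 2 : ℝ) : ℂ) =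
      ((q * ∑ u, ‖c u‖ ^ 2 : ℝ) : ℂ) := by
    rw [Complex.ofReal_sum]
    simp_rw [normSq_sum_stdAddChar, ← mul_sub]
    rw [sum_comm]
    simp_rw [sum_comm (s := (univ : Finset (ZMod q))) (t := (univ : Finset (ZMod q)))
      (f := fun l k => _ * (starRingEnd ℂ) (c k) * stdAddChar (l * (h * (_ - k)))), ← mul_sum,
      sum_stdAddChar_mul, mul_eq_zero, or_iff_right hh, sub_eq_zero]
    simp [mul_sum, Complex.mul_conj', mul_comm]
  exact_mod_cast key

theorem sum_sum_sub {M : Type*} [AddCommMonoid M] (A : Finset (ZMod q)) (f : ZMod q → M) :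
    ∑ u ∈ A, ∑ v ∈ A, f (u - v) = ∑ l, diffCount A l • f l := by
  rw [← sum_product', ← sum_fiberwise (A ×ˢ A) fun p : ZMod q × ZMod q => p.1 - p.2]
  refine sum_congr rfl fun l _ => ?_
  rw [sum_congr rfl (g := fun _ => f l) fun p hp => by rw [(mem_filter.1 hp).2], sum_const]
  rfl

/-- Parseval: the squared modulus of the sum over `A` is the Fourier transform of `diffCount A`. -/
theorem sum_norm_pow_four_stdAddChar {h : ZMod q} (hh : h ≠ 0) (A : Finset (ZMod q)) :
    ∑ l : ZMod q, ‖∑ u ∈ A, stdAddChar (l * (h * u))‖ ^ 4 =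
      q * ∑ l, (diffCount A l : ℝ) ^ 2 := by
  have hsq : ∀ l : ZMod q, ‖∑ u ∈ A, stdAddChar (l * (h * u))‖ ^ 2 =
      ‖∑ u, (diffCount A u : ℂ) * stdAddChar (l * (h * u))‖ := by
    intro l
    have h1 := normSq_sum_stdAddChar A (fun _ => (1 : ℂ)) fun u => l * (h * u)
    simp only [one_mul, map_one, ← mul_sub] at h1
    rw [sum_sum_sub A fun d => stdAddChar (l * (h * d))] at h1
    simp only [nsmul_eq_mul] at h1
    rw [← h1, Complex.norm_real, Real.norm_of_nonneg (by positivity)]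
  have := sum_norm_sq_stdAddChar hh fun u => (diffCount A u : ℂ)
  simp only [← hsq, Complex.norm_natCast, ← pow_mul] at this
  exact this

/-- Cauchy–Schwarz over `u` removes `f`; opening the square and grouping `(v, w)` by `l = v - w`
leaves `∑ r(l) |F(l)|`, where `F` is the exponential sum over `A`. Two more applications separate `∑
r`, `∑ r ^ 2` and the fourth moment of `F`. -/
theorem norm_bilinear_pow_eight_le {h : ZMod q} (hh : h ≠ 0) (A B : Finset (ZMod q))
    (f g : ZMod q → ℂ) (hf : ∀ u ∈ A, ‖f u‖ ≤ 1) (hg : ∀ v ∈ B, ‖g v‖ ≤ 1) :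
    ‖∑ u ∈ A, ∑ v ∈ B, f u * g v * stdAddChar (h * (u * v))‖ ^ 8 ≤
      ((#A : ℝ) * #B) ^ 4 * (q * (∑ l, (diffCount A l : ℝ) ^ 2) *
        ∑ l, (diffCount B l : ℝ) ^ 2) := by
  set S := ∑ u ∈ A, ∑ v ∈ B, f u * g v * stdAddChar (h * (u * v))
  set G : ZMod q → ℂ := fun u => ∑ v ∈ B, g v * stdAddChar (h * (u * v)) with hG
  set F : ZMod q → ℂ := fun l => ∑ u ∈ A, stdAddChar (l * (h * u)) with hF
  set r : ZMod q → ℝ := fun l => diffCount B l with hr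
  have hr0 : ∀ l, 0 ≤ r l := fun l => Nat.cast_nonneg _
  have h1 : ‖S‖ ≤ ∑ u ∈ A, ‖G u‖ := by
    refine norm_sum_le_of_le _ fun u hu => ?_
    have : ∑ v ∈ B, f u * g v * stdAddChar (h * (u * v)) = f u * G u := by
      rw [hG, mul_sum]; exact sum_congr rfl fun v _ => by ring
    rw [this, norm_mul]
    exact mul_le_of_le_one_left (norm_nonneg _) (hf u hu)
  have h2 : ‖S‖ ^ 2 ≤ #A * ∑ u ∈ A, ‖G u‖ ^ 2 :=
    (pow_le_pow_left₀ (norm_nonneg _) h1 2).trans sq_sum_le_card_mul_sum_sq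
  have h3 : ∑ u ∈ A, ‖G u‖ ^ 2 ≤ ∑ l, r l * ‖F l‖ := by
    have e1 : ((∑ u ∈ A, ‖G u‖ ^ 2 : ℝ) : ℂ) =
        ∑ v ∈ B, ∑ w ∈ B, g v * (starRingEnd ℂ) (g w) * F (v - w) := by
      rw [Complex.ofReal_sum]
      simp_rw [hG, normSq_sum_stdAddChar]
      rw [sum_comm]
      refine sum_congr rfl fun v _ => ?_
      rw [sum_comm]
      refine sum_congr rfl fun w _ => ?_
      rw [← mul_sum]
      congr 1
      exact sum_congr rfl fun u _ => congrArg _ (by ring)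
    have e2 : ∑ u ∈ A, ‖G u‖ ^ 2 = ‖((∑ u ∈ A, ‖G u‖ ^ 2 : ℝ) : ℂ)‖ := by
      rw [Complex.norm_real, Real.norm_of_nonneg (sum_nonneg fun _ _ => by positivity)]
    have e3 := sum_sum_sub B fun l => ‖F l‖
    simp only [nsmul_eq_mul] at e3
    rw [e2, e1, hr, ← e3]
    refine norm_sum_le_of_le _ fun v hv => norm_sum_le_of_le _ fun w hw => ?_
    rw [norm_mul, norm_mul, Complex.norm_conj]
    exact mul_le_of_le_one_left (norm_nonneg _)
      (mul_le_one₀ (hg v hv) (norm_nonneg _) (hg w hw))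
  have h4 : (∑ l, r l * ‖F l‖) ^ 2 ≤ (∑ l, r l) * ∑ l, r l * ‖F l‖ ^ 2 :=
    sum_sq_le_sum_mul_sum_of_sq_le_mul _ (fun l _ => hr0 l)
      (fun l _ => mul_nonneg (hr0 l) (sq_nonneg _)) fun l _ => by
        rw [mul_pow]; exact le_of_eq (by ring)
  have h5 : (∑ l, r l * ‖F l‖ ^ 2) ^ 2 ≤ (∑ l, r l ^ 2) * ∑ l, ‖F l‖ ^ 4 := by
    have := sum_mul_sq_le_sq_mul_sq univ r fun l => ‖F l‖ ^ 2
    simpa only [← pow_mul] using this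
  have h6 : ∑ l, r l = (#B : ℝ) ^ 2 := by
    simp only [hr]; exact_mod_cast sum_diffCount B
  rw [hF, sum_norm_pow_four_stdAddChar hh A] at h5
  have h7 : (∑ l, r l * ‖F l‖) ^ 4 ≤ (#B : ℝ) ^ 4 * ((∑ l, r l ^ 2) *
      (q * ∑ l, (diffCount A l : ℝ) ^ 2)) := by
    calc (∑ l, r l * ‖F l‖) ^ 4 = ((∑ l, r l * ‖F l‖) ^ 2) ^ 2 := by ring
      _ ≤ ((#B : ℝ) ^ 2 * ∑ l, r l * ‖F l‖ ^ 2) ^ 2 := by rw [← h6]; gcongr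
      _ = (#B : ℝ) ^ 4 * (∑ l, r l * ‖F l‖ ^ 2) ^ 2 := by ring
      _ ≤ _ := by gcongr
  calc ‖S‖ ^ 8 = (‖S‖ ^ 2) ^ 4 := by ring
    _ ≤ (#A * ∑ l, r l * ‖F l‖) ^ 4 :=
        pow_le_pow_left₀ (by positivity) (h2.trans (by gcongr)) 4
    _ = (#A : ℝ) ^ 4 * (∑ l, r l * ‖F l‖) ^ 4 := by ring
    _ ≤ (#A : ℝ) ^ 4 * ((#B : ℝ) ^ 4 * ((∑ l, r l ^ 2) *
          (q * ∑ l, (diffCount A l : ℝ) ^ 2))) := by gcongr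
    _ = _ := by ring

end Bilinear

/-! ### Factoring the square roots -/

section Decomposition

variable {q : ℕ} [Fact q.Prime]

open ZMod

/-- Since `m < N < q`, the residue `u ^ 2 / j` recovers the integer `m`, so weights in `m` become
weights in `u`. -/
theorem sum_rootSet {M : Type*} [AddCommMonoid M] {j : ZMod q} (hj : j ≠ 0) {N : ℕ}
    (hN : 2 * N ≤ q) (φ : ℕ → ZMod q → M) :
    ∑ u ∈ rootSet q j N, φ (u ^ 2 / j).val u =
      ∑ m ∈ dyadicInterval N, ∑ u ∈ univ.filter (fun u : ZMod q => u ^ 2 = j * m), φ m u := by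
  have hval : ∀ m ∈ dyadicInterval N, ∀ u : ZMod q, u ^ 2 = j * m → (u ^ 2 / j).val = m := by
    intro m hm u hu
    rw [hu, mul_div_cancel_left₀ _ hj, ZMod.val_cast_of_lt]
    have := (mem_dyadicInterval.1 hm).1
    omega
  rw [← sum_fiberwise_of_maps_to (s := rootSet q j N) (t := dyadicInterval N)
    (g := fun u => (u ^ 2 / j).val)]
  · refine sum_congr rfl fun m hm => ?_
    have hset : (rootSet q j N).filter (fun u => (u ^ 2 / j).val = m) =
        univ.filter (fun u : ZMod q => u ^ 2 = j * m) := by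
      ext u
      simp only [rootSet, mem_filter, mem_univ, true_and]
      constructor
      · rintro ⟨⟨m', hm', hu⟩, h⟩
        rw [hval m' hm' u hu] at h
        rwa [← h]
      · exact fun hu => ⟨⟨m, hm, hu⟩, hval m hm u hu⟩
    rw [← hset]
    exact sum_congr rfl fun u hu => by rw [(mem_filter.1 hu).2]
  · intro u hu
    obtain ⟨m, hm, hum⟩ := (mem_filter.1 hu).2
    rwa [hval m hm u hum]

/-- Averaging over `c` the factorizations `x = u v`, `u ^ 2 = c m`, `v ^ 2 = (a / c) n` of the
square roots `x` of `a m n`. -/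
theorem sum_factored_roots {M : Type*} [AddCommMonoid M] {a m n : ZMod q}
    (hm : m ≠ 0) (φ : ZMod q → M) :
    ∑ c ∈ univ.filter (fun c : ZMod q => c ≠ 0),
      ∑ u ∈ univ.filter (fun u : ZMod q => u ^ 2 = c * m),
        ∑ v ∈ univ.filter (fun v : ZMod q => v ^ 2 = a / c * n), φ (u * v) =
      (q - 1) • ∑ x ∈ univ.filter (fun x : ZMod q => x ^ 2 = a * m * n), φ x := by
  -- For fixed `u ≠ 0`, necessarily `c = u ^ 2 / m`, and `v ↦ u v` is a bijection onto the roots of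
  -- `a m n`. Hence each root is counted once for each of the `q - 1` nonzero `u`.
  have hinner : ∀ u : ZMod q, u ≠ 0 →
      ∑ v ∈ univ.filter (fun v : ZMod q => v ^ 2 = a / (u ^ 2 / m) * n), φ (u * v) =
        ∑ x ∈ univ.filter (fun x : ZMod q => x ^ 2 = a * m * n), φ x := by
    intro u hu
    refine sum_nbij' (fun v => u * v) (fun x => x / u) ?_ ?_ ?_ ?_ fun _ _ => rfl
    · intro v hv
      simp only [mem_filter, mem_univ, true_and] at hv ⊢
      rw [mul_pow, hv]; field_simp
    · intro x hx
      simp only [mem_filter, mem_univ, true_and] at hx ⊢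
      rw [div_pow, hx]; field_simp
    · intro v _; field_simp
    · intro x _; field_simp
  have houter : ∑ c ∈ univ.filter (fun c : ZMod q => c ≠ 0),
      ∑ u ∈ univ.filter (fun u : ZMod q => u ^ 2 = c * m),
        ∑ v ∈ univ.filter (fun v : ZMod q => v ^ 2 = a / c * n), φ (u * v) =
      ∑ u ∈ univ.filter (fun u : ZMod q => u ≠ 0),
        ∑ v ∈ univ.filter (fun v : ZMod q => v ^ 2 = a / (u ^ 2 / m) * n), φ (u * v) := by
    rw [sum_sigma']
    refine sum_nbij' (fun x => x.2) (fun u => ⟨u ^ 2 / m, u⟩) ?_ ?_ ?_ ?_ ?_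
    · rintro ⟨c, u⟩ hx
      simp only [mem_sigma, mem_filter, mem_univ, true_and] at hx ⊢
      rintro rfl
      exact mul_ne_zero hx.1 hm (by rw [← hx.2]; ring)
    · intro u hu
      simp only [mem_sigma, mem_filter, mem_univ, true_and] at hu ⊢
      exact ⟨div_ne_zero (pow_ne_zero 2 hu) hm, by field_simp⟩
    · rintro ⟨c, u⟩ hx
      simp only [mem_sigma, mem_filter, mem_univ, true_and] at hx ⊢
      rw [hx.2, mul_div_cancel_right₀ _ hm]
    · intro u _; rfl
    · rintro ⟨c, u⟩ hx
      simp only [mem_sigma, mem_filter, mem_univ, true_and] at hx ⊢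
      rw [hx.2, mul_div_cancel_right₀ _ hm]
  rw [houter, sum_congr rfl fun u hu => hinner u (mem_filter.1 hu).2, sum_const]
  congr 1
  rw [filter_ne' univ (0 : ZMod q), card_erase_of_mem (mem_univ _), card_univ, ZMod.card]

theorem nsmul_bilinearRootSum {a h : ZMod q} (ha : a ≠ 0) (α β : ℕ → ℂ) {M N : ℕ}
    (hM : 2 * M ≤ q) (hN : 2 * N ≤ q) :
    (q - 1) • bilinearRootSum q a h α β M N =
      ∑ c ∈ univ.filter (fun c : ZMod q => c ≠ 0),
        ∑ u ∈ rootSet q c M, ∑ v ∈ rootSet q (a / c) N,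
          α (u ^ 2 / c).val * β (v ^ 2 / (a / c)).val * stdAddChar (h * (u * v)) := by
  have hstep : ∀ c ∈ univ.filter (fun c : ZMod q => c ≠ 0),
      ∑ u ∈ rootSet q c M, ∑ v ∈ rootSet q (a / c) N,
        α (u ^ 2 / c).val * β (v ^ 2 / (a / c)).val * stdAddChar (h * (u * v)) =
      ∑ m ∈ dyadicInterval M, ∑ n ∈ dyadicInterval N,
        α m * β n * ∑ u ∈ univ.filter (fun u : ZMod q => u ^ 2 = c * m),
          ∑ v ∈ univ.filter (fun v : ZMod q => v ^ 2 = a / c * n), stdAddChar (h * (u * v)) := by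
    intro c hc
    have hc0 : c ≠ 0 := (mem_filter.1 hc).2
    rw [sum_rootSet hc0 hM fun m u => ∑ v ∈ rootSet q (a / c) N,
      α m * β (v ^ 2 / (a / c)).val * stdAddChar (h * (u * v))]
    refine sum_congr rfl fun m _ => ?_
    rw [sum_congr rfl fun u _ => sum_rootSet (div_ne_zero ha hc0) hN fun n v =>
      α m * β n * stdAddChar (h * (u * v)), sum_comm]
    refine sum_congr rfl fun n _ => ?_
    rw [mul_sum]
    exact sum_congr rfl fun u _ => (mul_sum _ _ _).symm
  rw [sum_congr rfl hstep, sum_comm, bilinearRootSum, smul_sum]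
  refine sum_congr rfl fun m hm => ?_
  rw [sum_comm, smul_sum]
  refine sum_congr rfl fun n _ => ?_
  obtain ⟨h1, h2⟩ := mem_dyadicInterval.1 hm
  have hm0 : (m : ZMod q) ≠ 0 := natCast_zmod_ne_zero (by omega) (by omega)
  rw [← mul_sum, sum_factored_roots hm0 fun x => stdAddChar (h * x), mul_smul_comm]

/-- There are `q - 1` values of `c` against a factor `q - 1`, so a bound uniform in `c` passes to
the mean. -/
theorem norm_bilinearRootSum_le {a h : ZMod q} (ha : a ≠ 0) (hh : h ≠ 0) {α β : ℕ → ℂ} {M N : ℕ}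
    (hM : 2 * M ≤ q) (hN : 2 * N ≤ q) (hα : ∀ m ∈ dyadicInterval M, ‖α m‖ ≤ 1)
    (hβ : ∀ n ∈ dyadicInterval N, ‖β n‖ ≤ 1) {X : ℝ} (hX0 : 0 ≤ X)
    (hX : ∀ c : ZMod q, c ≠ 0 → (2 * M * (2 * N) : ℝ) ^ 4 *
      (q * (∑ l, (diffCount (rootSet q c M) l : ℝ) ^ 2) *
        ∑ l, (diffCount (rootSet q (a / c) N) l : ℝ) ^ 2) ≤ X ^ 8) :
    ‖bilinearRootSum q a h α β M N‖ ≤ X := by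
  have hval : ∀ (γ : ℕ → ℂ) (K : ℕ), 2 * K ≤ q → (∀ m ∈ dyadicInterval K, ‖γ m‖ ≤ 1) →
      ∀ j : ZMod q, j ≠ 0 → ∀ u ∈ rootSet q j K, ‖γ (u ^ 2 / j).val‖ ≤ 1 := by
    intro γ K hK hγ j hj u hu
    obtain ⟨m, hm, hum⟩ := (mem_filter.1 hu).2
    have h1 := (mem_dyadicInterval.1 hm).1
    rw [hum, mul_div_cancel_left₀ _ hj, ZMod.val_cast_of_lt (by omega)]
    exact hγ m hm
  have hS : ∀ c ∈ univ.filter (fun c : ZMod q => c ≠ 0),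
      ‖∑ u ∈ rootSet q c M, ∑ v ∈ rootSet q (a / c) N,
        α (u ^ 2 / c).val * β (v ^ 2 / (a / c)).val * stdAddChar (h * (u * v))‖ ≤ X := by
    intro c hc
    have hc0 : c ≠ 0 := (mem_filter.1 hc).2
    refine le_of_pow_le_pow_left₀ (n := 8) (by norm_num) hX0 (le_trans ?_ (hX c hc0))
    refine (norm_bilinear_pow_eight_le hh _ _ (fun u => α (u ^ 2 / c).val)
      (fun v => β (v ^ 2 / (a / c)).val) (hval α M hM hα c hc0)
      (hval β N hN hβ _ (div_ne_zero ha hc0))).trans ?_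
    have h1 : (#(rootSet q c M) : ℝ) ≤ 2 * M := by exact_mod_cast card_rootSet_le c M
    have h2 : (#(rootSet q (a / c) N) : ℝ) ≤ 2 * N := by exact_mod_cast card_rootSet_le _ N
    gcongr
  have hsum := norm_sum_le_of_le _ hS
  have hq1 : 0 < q - 1 := Nat.sub_pos_of_lt (Fact.out : q.Prime).one_lt
  rw [← nsmul_bilinearRootSum ha α β hM hN, nsmul_eq_mul, norm_mul, Complex.norm_natCast,
    sum_const, nsmul_eq_mul, filter_ne' univ (0 : ZMod q), card_erase_of_mem (mem_univ _),
    card_univ, ZMod.card] at hsum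
  exact le_of_mul_le_mul_left hsum (by exact_mod_cast hq1)

end Decomposition

/-! ### Conclusion -/

/-- The quotient on the right is the sixteenth root of `N ^ 3 / q`, so the square root is its eighth
power, and `y ^ 8 + 1 ≤ (y + 1) ^ 8`. -/
theorem one_add_sqrt_le_rpow (N q : ℕ) :
    1 + √((N : ℝ) ^ 3 / q) ≤
      ((N : ℝ) ^ ((3 : ℝ) / 16) / (q : ℝ) ^ ((1 : ℝ) / 16) + 1) ^ 8 := by
  set y := (N : ℝ) ^ ((3 : ℝ) / 16) / (q : ℝ) ^ ((1 : ℝ) / 16) with hy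
  have hy0 : 0 ≤ y := by positivity
  have h16 : y ^ 16 = (N : ℝ) ^ 3 / q := by
    rw [hy, div_pow, ← Real.rpow_natCast, ← Real.rpow_natCast, ← Real.rpow_mul (by positivity),
      ← Real.rpow_mul (by positivity)]
    norm_num
  have h8 : √((N : ℝ) ^ 3 / q) = y ^ 8 := by
    rw [← h16, show y ^ 16 = (y ^ 8) ^ 2 by ring, Real.sqrt_sq (by positivity)]
  have hadd : y ^ 8 + 1 ^ 8 ≤ (y + 1) ^ 8 := pow_add_pow_le hy0 zero_le_one (by norm_num)
  rw [h8]
  linarith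

/-- The factor `q ^ (1 / 8 + o(1))` (as `q → ∞` over primes, uniformly in everything else) reads:
for every `ε > 0` the bound holds with `q ^ (1 / 8 + ε)` for all primes `q ≥ q₀(ε)`. -/
theorem corollary2p1 (ε : ℝ) (hε : 0 < ε) :
    ∃ q₀ : ℕ, ∀ (q : ℕ) [Fact q.Prime], q₀ ≤ q →
      ∀ (a h : ZMod q), a ≠ 0 → h ≠ 0 →
      ∀ (M N : ℕ), 0 < M → 0 < N → (M : ℝ) ≤ (q : ℝ) / 2 → (N : ℝ) ≤ (q : ℝ) / 2 →
      ∀ (α β : ℕ → ℂ), (∀ m ∈ dyadicInterval M, ‖α m‖ ≤ 1) →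
        (∀ n ∈ dyadicInterval N, ‖β n‖ ≤ 1) →
        ‖bilinearRootSum q a h α β M N‖ ≤
          (q : ℝ) ^ ((1 : ℝ) / 8 + ε) * ((N : ℝ) * (M : ℝ)) ^ ((3 : ℝ) / 4) *
            ((N : ℝ) ^ ((3 : ℝ) / 16) / (q : ℝ) ^ ((1 : ℝ) / 16) + 1) *
            ((M : ℝ) ^ ((3 : ℝ) / 16) / (q : ℝ) ^ ((1 : ℝ) / 16) + 1) := by

  -- The eighth power leaves `q ^ (8 ε)` to spend: `2 ε` on each energy, and `4 ε` to absorb `256 C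
  -- ^ 2`, where `256 = 4 ^ 4` comes from the sizes `2 M` and `2 N` of the root sets.
  obtain ⟨C, hC, hE⟩ := exists_energy_bound (2 * ε) (by linarith)
  obtain ⟨q₁, hq₁⟩ := exists_nat_ge ((256 * C ^ 2) ^ (1 / (4 * ε)))
  refine ⟨max 3 q₁, ?_⟩
  intro q _ hq a h ha hh M N hM hN hMq hNq α β hα hβ
  have hq3 : 3 ≤ q := (le_max_left _ _).trans hq
  have hqq₁ : q₁ ≤ q := (le_max_right _ _).trans hq
  have hq0 : (0 : ℝ) < q := by exact_mod_cast (show 0 < q by omega)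
  have h2 : (2 : ZMod q) ≠ 0 := by
    exact_mod_cast natCast_zmod_ne_zero (q := q) (n := 2) (by norm_num) (by omega)
  have hM2 : 2 * M ≤ q := by
    have : (2 : ℝ) * M ≤ q := by linarith
    exact_mod_cast this
  have hN2 : 2 * N ≤ q := by
    have : (2 : ℝ) * N ≤ q := by linarith
    exact_mod_cast this
  have hbig : 256 * C ^ 2 ≤ (q : ℝ) ^ (4 * ε) := by
    have h1 : (256 * C ^ 2) ^ (1 / (4 * ε)) ≤ (q : ℝ) := hq₁.trans (by exact_mod_cast hqq₁)
    calc 256 * C ^ 2 = ((256 * C ^ 2) ^ (1 / (4 * ε))) ^ (4 * ε) := by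
          rw [← Real.rpow_mul (by positivity), one_div_mul_cancel (by positivity), Real.rpow_one]
      _ ≤ _ := Real.rpow_le_rpow (by positivity) h1 (by positivity)
  refine norm_bilinearRootSum_le ha hh hM2 hN2 hα hβ (by positivity) fun c hc => ?_
  have hEM := hE q h2 c hc M hM hM2
  have hEN := hE q h2 (a / c) (div_ne_zero ha hc) N hN hN2
  have hyM := one_add_sqrt_le_rpow M q
  have hyN := one_add_sqrt_le_rpow N q
  set yM := (M : ℝ) ^ ((3 : ℝ) / 16) / (q : ℝ) ^ ((1 : ℝ) / 16) + 1
  set yN := (N : ℝ) ^ ((3 : ℝ) / 16) / (q : ℝ) ^ ((1 : ℝ) / 16) + 1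
  have hyN0 : 0 ≤ yN := by positivity
  have hyM0 : 0 ≤ yM := by positivity
  have hq8 : ((q : ℝ) ^ ((1 : ℝ) / 8 + ε)) ^ 8 =
      q * (q : ℝ) ^ (4 * ε) * ((q : ℝ) ^ (2 * ε) * (q : ℝ) ^ (2 * ε)) := by
    rw [← Real.rpow_natCast, ← Real.rpow_mul hq0.le, ← Real.rpow_add hq0]
    nth_rw 2 [← Real.rpow_one (q : ℝ)]
    rw [← Real.rpow_add hq0, ← Real.rpow_add hq0]
    congr 1
    push_cast
    ring
  have hNM8 : (((N : ℝ) * M) ^ ((3 : ℝ) / 4)) ^ 8 = ((N : ℝ) * M) ^ 6 := by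
    rw [← Real.rpow_natCast, ← Real.rpow_mul (by positivity), ← Real.rpow_natCast]
    norm_num
  set Q := (q : ℝ) ^ (2 * ε)
  calc _ ≤ (2 * M * (2 * N) : ℝ) ^ 4 *
        (q * (C * Q * ((M : ℝ) ^ 2 * yM ^ 8)) * (C * Q * ((N : ℝ) ^ 2 * yN ^ 8))) := by
        gcongr
        · exact hEM.trans (by gcongr)
        · exact hEN.trans (by gcongr)
    _ = q * (256 * C ^ 2) * (Q * Q) * ((N : ℝ) * M) ^ 6 * yN ^ 8 * yM ^ 8 := by ring
    _ ≤ q * (q : ℝ) ^ (4 * ε) * (Q * Q) * ((N : ℝ) * M) ^ 6 * yN ^ 8 * yM ^ 8 := by gcongr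
    _ = _ := by rw [← hNM8, ← hq8, ← mul_pow, ← mul_pow, ← mul_pow]
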